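/- Notation. Let $A_1,\dots,A_c$ be graphs ("atoms") on $[n]$ whose union is connected and such that each $\underline A_j$ ($A_j$ with isolated vertices removed) is nonempty and connected. Fix $v_1\in[n]$. The additive product graph $X=A_1\oplus\cdots\oplus A_c$ has as vertices the strings $v_1C_1v_2C_2\cdots v_kC_kv_{k+1}$ ($k\ge 0$, $v_i\in[n]$, $C_i\in[c]$) with $C_i\ne C_{i+1}$ and with $v_i\neq v_{i+1}$ both in $\underline A_{C_i}$. Its edges are the pairs $\{s,sCv\}$ and $\{sCu,sCv\}$, where the last vertices of the two strings form an edge of $A_C$; such an edge is called of type $C$. Distances $\mathrm{dis}$ below are taken in the atom named in the formula. For a finite graph $H=(W,E)$, angles $\Theta=(\alpha,\beta,\gamma,\delta)\in\mathbb R^{4p}$ and unit vectors $\boldsymbol m_v,\boldsymbol n_v\in S^2$ ($v\in W$), put $\mathsf A=\sum_{uv\in E}Z_uZ_v$, $\mathsf B=\sum_vX_v$, $\mathsf C=\sum_vZ_v$, $\mathsf D=\sum_v\boldsymbol n_v\cdot(X_v,Y_v,Z_v)$ and $$|\Theta,H,\boldsymbol n,\boldsymbol m\rangle=e^{-i\delta_p\mathsf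 D}e^{-i\gamma_p\mathsf C}e^{-i\beta_p\mathsf B}e^{-i\alpha_p\mathsf A}\cdots e^{-i\delta_1\mathsf D}e^{-i\gamma_1\mathsf C}e^{-i\beta_1\mathsf B}e^{-i\alpha_1\mathsf A}\bigotimes_v|\boldsymbol m_v\rangle ,$$ where $|\boldsymbol m_v\rangle$ is the qubit state with Bloch vector $\boldsymbol m_v$. Let the pairs $(\boldsymbol m_v,\boldsymbol n_v)$ be independent over $v$ with a common law $\mu$ on $S^2\times S^2$, and write $\mathbb E_{\boldsymbol m,\boldsymbol n}$ for the average over them. For $z=(z^{[1]},\dots,z^{[p+1]},z^{[-(p+1)]},\dots,z^{[-1]})\in\{\pm1\}^{2p+2}$ and a one-qubit operator $\sigma$ put $$f^\sigma(z)=\mathbb E_{(\boldsymbol m,\boldsymbol n)\sim\mu}\Big[\langle \boldsymbol m|z^{[1]}\rangle\prod_{j=1}^p\langle z^{[j]}|e^{i\beta_jX}e^{i\gamma_jZ}e^{i\delta_j\boldsymbol n\cdot(X,Y,Z)}|z^{[j+1]}\rangle\;\langle z^{[p+1]}|\sigma|z^{[-(p+1)]}\rangle\prod_{j=1}^p\langle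 z^{[-(j+1)]}|e^{-i\delta_j\boldsymbol n\cdot(X,Y,Z)}e^{-i\gamma_jZ}e^{-i\beta_jX}|z^{[-j]}\rangle\;\langle z^{[-1]}|\boldsymbol m\rangle\Big],$$ and let $\mathcal A=(\alpha_1,\dots,\alpha_p,0,0,-\alpha_p,\dots,-\alpha_1)$. Products $z_kz_l$ of configurations are entrywise. Define recursively, for $m\ge0$, $C\in[c]$, $a\in[n]$, $$G^{[m]}_{C,a}(z_a)=\sum_{\{z_k\}:\ 0<\mathrm{dis}(k,a)\le m}\ \prod_{k\ne a}\Big[f^I(z_k)\prod_{C'\ne C}G^{[m-\mathrm{dis}(k,a)]}_{C',k}(z_k)\Big]\exp\Big[i\,\mathcal A\cdot\sum_{k_1k_2}z_{k_1}z_{k_2}\Big],$$ where $k$ runs over vertices at distance at most $m$ from $a$ in $A_C$ and $k_1k_2$ over the edges of $A_C$ between vertices at distance at most $m$ from $a$; in particular $G^{[0]}_{C,a}=1$. For an edge $ab$ of $A_C$ and a one-qubit operator $\sigma$ put, with $d(k)=\min(\mathrm{dis}(k,a),\mathrm{dis}(k,b))$, $$F^\sigma_{C,a,b}=\sum_{\{z_k\}:\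 d(k)\le p}\ \prod_k\Big[f^{\tilde\sigma_k}(z_k)\prod_{C'\ne C}G^{[p-d(k)]}_{C',k}(z_k)\Big]\exp\Big[i\,\mathcal A\cdot\sum_{k_1k_2}z_{k_1}z_{k_2}\Big],$$ where $k$ runs over the vertices with $d(k)\le p$, $k_1k_2$ over the edges of $A_C$ between such vertices, $\tilde\sigma_k=\sigma$ for $k\in\{a,b\}$ and $\tilde\sigma_k=I$ otherwise. Statement. Let $p\ge 0$, let $\Theta\in\mathbb R^{4p}$, let $\mu$ be a Borel probability measure on $S^2\times S^2$, let $ab$ be an edge of $A_C$, and let $\{L,R\}$ be an edge of type $C$ of $X$ whose endpoints $L$, $R$ are strings ending in $a$, $b$. Let $S$ be any finite set of vertices of $X$ that contains all vertices at distance at most $p$ from $L$ or $R$, and let $H=X[S]$ be the induced subgraph. Then $$\mathbb E_{\boldsymbol m,\boldsymbol n}\langle\Theta,H,\boldsymbol n,\boldsymbol m|\,\sigma_L\sigma_R\,|\Theta,H,\boldsymbol n,\boldsymbol m\rangle=F^\sigma_{C,a,b}\qquad(\sigma\in\{I,X,Y,Z\}),$$ and consequently $$\mathbb E_{\boldsymbol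 m,\boldsymbol n}\langle\Theta,H,\boldsymbol n,\boldsymbol m|\,\tfrac12(1-X_LX_R-Y_LY_R-Z_LZ_R)\,|\Theta,H,\boldsymbol n,\boldsymbol m\rangle=\tfrac12\big(F^I_{C,a,b}-F^X_{C,a,b}-F^Y_{C,a,b}-F^Z_{C,a,b}\big).$$ In particular, the value depends only on $C,a,b$, not on $L$, $R$ or $S$. -/

import Mathlib

/-! ### Additive product graphs -/

namespace AdditiveProduct

variable {n c : ℕ}

/-- The standing assumptions on the plain atoms: the sum graph (union of the atoms) is connected,
and each atom, with its isolated vertices removed, is nonempty and connected. -/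
structure IsAtomFamily (A : Fin c → SimpleGraph (Fin n)) : Prop where
  sum_connected : (⨆ C, A C).Connected
  atom_connected : ∀ C, ((A C).induce (A C).support).Connected

/-- The last vertex `v_{k+1}` of the string `v₁ C₁ v₂ C₂ ⋯ C_k v_{k+1}`. Such a string is encoded
by the list `[(C_k, v_{k+1}), …, (C₁, v₂)]` (most recent step first). -/
def endpoint (v₁ : Fin n) : List (Fin c × Fin n) → Fin n
  | [] => v₁
  | (_, u) :: _ => u

/-- Admissible strings: consecutive atoms are different, and consecutive vertices `v_i`, `v_{i+1}`
are two different non-isolated vertices of the atom `C_i` between them. -/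
def IsString (A : Fin c → SimpleGraph (Fin n)) (v₁ : Fin n) : List (Fin c × Fin n) → Prop
  | [] => True
  | (C, u) :: s =>
      IsString A v₁ s ∧ (∀ q ∈ s.head?, q.1 ≠ C) ∧
        endpoint v₁ s ∈ (A C).support ∧ u ∈ (A C).support ∧ u ≠ endpoint v₁ s

/-- The vertex set of the additive product graph. -/
abbrev Vertex (A : Fin c → SimpleGraph (Fin n)) (v₁ : Fin n) : Type :=
  {s : List (Fin c × Fin n) // IsString A v₁ s}

/-- The vertex of `[n]` at which the string `x` ends. -/
def Vertex.last {A : Fin c → SimpleGraph (Fin n)} {v₁ : Fin n} (x : Vertex A v₁) : Fin n :=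
  endpoint v₁ x.1

/-- `IsEdgeOfType C x y`: the pair `{x, y}` is of the form `{s, sCv}` or `{sCu, sCv}`, where the
last vertices of `x` and `y` are adjacent in the atom `C`. -/
def IsEdgeOfType {A : Fin c → SimpleGraph (Fin n)} {v₁ : Fin n} (C : Fin c)
    (x y : Vertex A v₁) : Prop :=
  (A C).Adj x.last y.last ∧
    (y.1 = (C, y.last) :: x.1 ∨ x.1 = (C, x.last) :: y.1 ∨
      ∃ s, x.1 = (C, x.last) :: s ∧ y.1 = (C, y.last) :: s)

/-- The additive product graph `A₁ ⊕ ⋯ ⊕ A_c` with base vertex `v₁`. -/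
def graph (A : Fin c → SimpleGraph (Fin n)) (v₁ : Fin n) : SimpleGraph (Vertex A v₁) where
  Adj x y := ∃ C, IsEdgeOfType C x y
  symm := ⟨by
    rintro x y ⟨C, hadj, h⟩
    refine ⟨C, hadj.symm, ?_⟩
    rcases h with h | h | ⟨s, h, h'⟩
    · exact Or.inr (Or.inl h)
    · exact Or.inl h
    · exact Or.inr (Or.inr ⟨s, h', h⟩)⟩
  loopless := ⟨by
    rintro x ⟨C, hadj, -⟩
    exact (A C).loopless.irrefl _ hadj⟩

end AdditiveProduct

/-- The vertices of `H` at distance at most `m` from the set `T`. -/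
def SimpleGraph.nbhd {W : Type*} (H : SimpleGraph W) (T : Set W) (m : ℕ) : Set W :=
  {k | ∃ t ∈ T, H.edist t k ≤ m}

theorem SimpleGraph.mem_nbhd_of_mem {W : Type*} (H : SimpleGraph W) {T : Set W} (m : ℕ) {a : W}
    (ha : a ∈ T) : a ∈ H.nbhd T m :=
  ⟨a, ha, by simp⟩

/-! ### Qubits and the Hamiltonian-QAOA state -/

namespace HamQAOA

open Matrix

/-- A `2 × 2` matrix in the computational basis `|+1⟩, |-1⟩`. -/
abbrev QubitOp : Type := Matrix ℤˣ ℤˣ ℂ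

def pauliX : QubitOp := Matrix.of fun s t => if s = t then 0 else 1

noncomputable def pauliY : QubitOp :=
  Matrix.of fun s t => if s = t then 0 else -Complex.I * ((s : ℤ) : ℂ)

def pauliZ : QubitOp := Matrix.diagonal fun s => ((s : ℤ) : ℂ)

/-- The unit sphere of directions in three-space. -/
abbrev Direction : Type := Metric.sphere (0 : EuclideanSpace ℝ (Fin 3)) 1

/-- `u · (X, Y, Z)`. -/
noncomputable def pauliDot (u : Direction) : QubitOp :=
  (u.1 0 : ℂ) • pauliX + (u.1 1 : ℂ) • pauliY + (u.1 2 : ℂ) • pauliZ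

/-- The qubit state `|u⟩` with Bloch vector `u` (unit eigenvector of `u · (X, Y, Z)` for the
eigenvalue `1`). -/
noncomputable def blochKet (u : Direction) : ℤˣ → ℂ := fun s =>
  if u.1 2 = -1 then (if s = 1 then 0 else 1)
  else if s = 1 then ((√((1 + u.1 2) / 2) : ℝ) : ℂ)
  else ((u.1 0 : ℂ) + Complex.I * (u.1 1 : ℂ)) / ((√(2 * (1 + u.1 2)) : ℝ) : ℂ)

/-- The `4p` angles of a depth-`p` circuit; the index `j : Fin p` stands for layer `j + 1`. -/
structure Angles (p : ℕ) where
  α : Fin p → ℝ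
  β : Fin p → ℝ
  γ : Fin p → ℝ
  δ : Fin p → ℝ

section State

variable {W : Type*} [Fintype W] [DecidableEq W]

/-- Operators on the qubits labelled by `W`, in the computational basis. -/
abbrev Op (W : Type*) : Type _ := Matrix (W → ℤˣ) (W → ℤˣ) ℂ

/-- The tensor product of the single-qubit operators `P v`. -/
noncomputable def tensorOp (P : W → QubitOp) : Op W :=
  Matrix.of fun x y => ∏ v, P v (x v) (y v)

/-- The operator acting as `P` on the qubit `v` and trivially on the others. -/
noncomputable def onQubit (v : W) (P : QubitOp) : Op W :=
  tensorOp (Function.update (fun _ => 1) v P)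

open Classical in
/-- `A = ∑_{uv ∈ E} Z_u Z_v`. -/
noncomputable def hamA (H : SimpleGraph W) : Op W :=
  ∑ e ∈ H.edgeFinset, tensorOp (fun w => if w ∈ e then pauliZ else 1)

/-- `B = ∑_v X_v`. -/
noncomputable def hamB : Op W := ∑ v, onQubit v pauliX

/-- `C = ∑_v Z_v`. -/
noncomputable def hamC : Op W := ∑ v, onQubit v pauliZ

/-- `D = ∑_v n_v · (X_v, Y_v, Z_v)`. -/
noncomputable def hamD (nn : W → Direction) : Op W := ∑ v, onQubit v (pauliDot (nn v))

/-- `e^{-iθK}`. -/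
noncomputable def evolve (θ : ℝ) (K : Op W) : Op W :=
  NormedSpace.exp ((-(Complex.I * (θ : ℂ))) • K)

/-- One layer `e^{-iδ_j D} e^{-iγ_j C} e^{-iβ_j B} e^{-iα_j A}`. -/
noncomputable def layer {p : ℕ} (H : SimpleGraph W) (Θ : Angles p) (nn : W → Direction)
    (j : Fin p) : Op W :=
  evolve (Θ.δ j) (hamD nn) * evolve (Θ.γ j) hamC * evolve (Θ.β j) hamB * evolve (Θ.α j) (hamA H)

/-- The state `|Θ, H, n, m⟩`: layers `1, …, p` applied successively to `⊗_v |m_v⟩`. -/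
noncomputable def state {p : ℕ} (H : SimpleGraph W) (Θ : Angles p) (nn mm : W → Direction) :
    (W → ℤˣ) → ℂ :=
  (List.ofFn (layer H Θ nn)).reverse.prod *ᵥ fun x => ∏ v, blochKet (mm v) (x v)

/-- `⟨ψ| O |ψ⟩`. -/
noncomputable def expect (ψ : (W → ℤˣ) → ℂ) (O : Op W) : ℂ := star ψ ⬝ᵥ (O *ᵥ ψ)

/-- The quantum MaxCut edge term `½(1 - X_u X_v - Y_u Y_v - Z_u Z_v)`. -/
noncomputable def qmcTerm (u v : W) : Op W :=
  (1 / 2 : ℂ) • (1 - onQubit u pauliX * onQubit v pauliX - onQubit u pauliY * onQubit v pauliY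
    - onQubit u pauliZ * onQubit v pauliZ)

/-- `𝔼_{m,n} ⟨Θ, H, n, m| O |Θ, H, n, m⟩`, where the pairs `(m_v, n_v)`, `v ∈ W`, are independent
with common law `μ`. -/
noncomputable def meanExpect {p : ℕ} (μ : MeasureTheory.Measure (Direction × Direction))
    [MeasureTheory.IsProbabilityMeasure μ] (H : SimpleGraph W) (Θ : Angles p) (O : Op W) : ℂ :=
  ∫ mn : W → Direction × Direction,
    expect (state H Θ (fun v => (mn v).2) (fun v => (mn v).1)) O
      ∂(MeasureTheory.Measure.pi fun _ => μ)

end State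

/-! ### The iterative formula -/

/-- Configuration vectors of length `2p + 2`: `z (inl j)` is `z^{[j+1]}` and `z (inr j)` is
`z^{[-(j+1)]}`, for `j = 0, …, p`. -/
abbrev Config (p : ℕ) : Type := Fin (p + 1) ⊕ Fin (p + 1) → ℤˣ

variable {p : ℕ}

/-- The vector `𝒜 = (α₁, …, α_p, 0, 0, -α_p, …, -α₁)`. -/
def paramVec (Θ : Angles p) : Fin (p + 1) ⊕ Fin (p + 1) → ℝ :=
  Sum.elim (Fin.snoc (α := fun _ => ℝ) Θ.α 0) (fun j => -Fin.snoc (α := fun _ => ℝ) Θ.α 0 j)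

/-- `e^{iβ_j X} e^{iγ_j Z} e^{iδ_j n·(X,Y,Z)}`. -/
noncomputable def braFactor (Θ : Angles p) (u : Direction) (j : Fin p) : QubitOp :=
  NormedSpace.exp ((Complex.I * (Θ.β j : ℂ)) • pauliX) *
    NormedSpace.exp ((Complex.I * (Θ.γ j : ℂ)) • pauliZ) *
    NormedSpace.exp ((Complex.I * (Θ.δ j : ℂ)) • pauliDot u)

/-- `e^{-iδ_j n·(X,Y,Z)} e^{-iγ_j Z} e^{-iβ_j X}`. -/
noncomputable def ketFactor (Θ : Angles p) (u : Direction) (j : Fin p) : QubitOp :=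
  NormedSpace.exp ((-(Complex.I * (Θ.δ j : ℂ))) • pauliDot u) *
    NormedSpace.exp ((-(Complex.I * (Θ.γ j : ℂ))) • pauliZ) *
    NormedSpace.exp ((-(Complex.I * (Θ.β j : ℂ))) • pauliX)

/-- The vertex weight `f^σ(z)` for a single-qubit operator `σ`. -/
noncomputable def vertexWeight (μ : MeasureTheory.Measure (Direction × Direction))
    (Θ : Angles p) (σ : QubitOp) (z : Config p) : ℂ :=
  ∫ mn : Direction × Direction,
    star (blochKet mn.1 (z (.inl 0))) *
      (∏ j : Fin p, braFactor Θ mn.2 j (z (.inl j.castSucc)) (z (.inl j.succ))) *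
      σ (z (.inl (Fin.last p))) (z (.inr (Fin.last p))) *
      (∏ j : Fin p, ketFactor Θ mn.2 j (z (.inr j.succ)) (z (.inr j.castSucc))) *
      blochKet mn.1 (z (.inr 0)) ∂μ

open Classical in
/-- `exp(i 𝒜 · ∑_{k₁k₂ ∈ E(H)} z_{k₁} z_{k₂})`, with the entrywise product of configurations. -/
noncomputable def edgePhase {W : Type*} [Fintype W] (Θ : Angles p) (H : SimpleGraph W)
    (z : W → Config p) : ℂ :=
  Complex.exp (Complex.I * ((∑ i, paramVec Θ i *
    ∑ e ∈ H.edgeFinset, ((((e.map fun k => z k i).mul : ℤˣ) : ℤ) : ℝ) : ℝ) : ℂ))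

variable {n c : ℕ}

open Classical in
/-- `G_{C,a}^{[m]}(z_a)`: the sum over all configurations on the vertices at distance at most `m`
from `a` in the atom `C` whose value at `a` is `z_a`. -/
noncomputable def branchSum (μ : MeasureTheory.Measure (Direction × Direction)) (Θ : Angles p)
    (A : Fin c → SimpleGraph (Fin n)) (m : ℕ) (C : Fin c) (a : Fin n) (za : Config p) : ℂ :=
  ∑ z : (A C).nbhd {a} m → Config p with z ⟨a, (A C).mem_nbhd_of_mem m rfl⟩ = za,
    (∏ k : {k : (A C).nbhd {a} m // k.1 ≠ a},
      (vertexWeight μ Θ 1 (z k) *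
        ∏ C' ∈ Finset.univ.erase C,
          branchSum μ Θ A (m - (A C).dist k.1.1 a) C' k.1.1 (z k))) *
      edgePhase Θ ((A C).induce ((A C).nbhd {a} m)) z
termination_by m
decreasing_by
  obtain ⟨⟨k, t, rfl, ht⟩, hk⟩ := k
  have hne : (A C).edist t k ≠ ⊤ := ne_top_of_le_ne_top (ENat.natCast_ne_top m) ht
  have hr : (A C).Reachable k t := (SimpleGraph.reachable_of_edist_ne_top hne).symm
  have hpos : 0 < (A C).dist k t := hr.pos_dist_of_ne hk
  have h0 : m ≠ 0 := by
    rintro rfl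
    have : (A C).edist t k = 0 := by simpa using ht
    exact hk (SimpleGraph.edist_eq_zero_iff.mp this).symm
  show m - (A C).dist k t < m
  omega

open Classical in
/-- The recursion starts at `G_{C,a}^{[0]} = 1`. -/
theorem branchSum_zero (μ : MeasureTheory.Measure (Direction × Direction))
    (Θ : Angles p) (A : Fin c → SimpleGraph (Fin n)) (C : Fin c) (a : Fin n) (za : Config p) :
    branchSum μ Θ A 0 C a za = 1 := by
  rw [branchSum]
  have huniq : ∀ k : (A C).nbhd {a} 0, k.1 = a := by
    rintro ⟨k, t, rfl, ht⟩
    have : (A C).edist t k = 0 := by simpa using ht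
    exact (SimpleGraph.edist_eq_zero_iff.mp this).symm
  rw [Finset.sum_eq_single (fun _ => za)]
  · have : IsEmpty {k : (A C).nbhd {a} 0 // k.1 ≠ a} := ⟨fun k => k.2 (huniq k.1)⟩
    rw [Finset.prod_of_isEmpty, one_mul, edgePhase]
    have h0 : ∀ _ : Fintype ((A C).induce ((A C).nbhd {a} 0)).edgeSet,
        ((A C).induce ((A C).nbhd {a} 0)).edgeFinset = ∅ := by
      intro _
      refine Finset.eq_empty_of_forall_notMem fun e => ?_
      induction e with
      | _ x y => simp [huniq x, huniq y]
    rw [h0]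
    simp
  · intro z hz hne
    exfalso; apply hne; funext k
    simp only [Finset.mem_filter] at hz
    rw [← hz.2]; congr 1; exact Subtype.ext (huniq k)
  · simp

open Classical in
/-- The sum over all configurations on the vertices of the atom `C` at distance at most `p` from
`{a, b}`, with vertex weight `f^σ` at `a` and `b` and `f^I` elsewhere. -/
noncomputable def edgeSum (μ : MeasureTheory.Measure (Direction × Direction)) (Θ : Angles p)
    (A : Fin c → SimpleGraph (Fin n)) (C : Fin c) (a b : Fin n) (σ : QubitOp) : ℂ :=
  ∑ z : (A C).nbhd {a, b} p → Config p,
    (∏ k : (A C).nbhd {a, b} p,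
      (vertexWeight μ Θ (if k.1 = a ∨ k.1 = b then σ else 1) (z k) *
        ∏ C' ∈ Finset.univ.erase C,
          branchSum μ Θ A (p - min ((A C).dist k.1 a) ((A C).dist k.1 b)) C' k.1 (z k))) *
      edgePhase Θ ((A C).induce ((A C).nbhd {a, b} p)) z

end HamQAOA

/-!
The expectation is a partition function. Writing each layer as a product of single-qubit matrices
times a diagonal matrix, and inserting computational-basis states between the layers, turns
`⟨Θ, H, n, m| σ_L σ_R |Θ, H, n, m⟩` into a sum over all assignments of a configuration in
`{±1}^{2p+2}` to each vertex of `H`; averaging over independent directions replaces the amplitude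
of each vertex by its weight `f^σ` (`HamQAOA.meanExpect_tensorOp`). The edges of `H` enter through
the phases `exp(i 𝒜 · zz')` only.

*Light cone.* If a vertex carries `f^I` and the rest of the summand depends only on its layers up
to `q`, then unitarity of the later layers restricts the sum to configurations whose two halves
agree at `q` (`HamQAOA.sum_vertexWeight_one_mul`). From the last layer downwards, this cancels the
phases of layer `j` on all edges with both ends at distance more than `p - j` from `{L, R}`. The
sum is therefore the same for all finite vertex sets that contain the ball of radius `p`
(`HamQAOA.marginal_eq_of_nbhd_subset`), and `H` may be replaced by any convenient such set.

*Tree structure.* The additive product graph is a tree of copies of atoms. Removing a vertex `k`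
leaves one part for each atom `C`, the set `AdditiveProduct.beyond C k` of what lies beyond `k` in
the copy of `C` through `k`: edges enter this set only from `k`, and are then of type `C`
(`AdditiveProduct.eq_of_adj_beyond`). The parts that hang at different vertices of one copy are
disjoint (`AdditiveProduct.mem_beyond_or`). This is independent of the position of the base vertex
of the strings. Hence the sum over the spins of a branch, defined by the same recursion on atom
distances as the iterative formula, is `branchSum` (`HamQAOA.marginal_branch`), and the sum over
the copy of `C` through the edge with all branches attached is `edgeSum`
(`HamQAOA.marginal_edgeNbhd`). This set contains the ball of radius `p`
(`HamQAOA.nbhd_subset_edgeNbhd`); no distances in the additive product graph need to be computed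
exactly. Both steps use sums over a part of the spins, `marginal`, which factor over parts joined
at single vertices (`marginal_glue`).
-/

/-! ### The tree of copies -/

namespace AdditiveProduct

variable {n c : ℕ} {A : Fin c → SimpleGraph (Fin n)} {v₁ : Fin n}

theorem IsString.of_suffix {s t : List (Fin c × Fin n)} (h : s <:+ t) (ht : IsString A v₁ t) :
    IsString A v₁ s := by
  obtain ⟨r, rfl⟩ := h
  induction r with
  | nil => exact ht
  | cons q r ih => exact ih ht.1

/-- The string `x` with its last step removed if that step is taken in the atom `C`. The strings
with a common stem are the vertices of one copy of the atom `C`. -/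
def stem (C : Fin c) (x : Vertex A v₁) : Vertex A v₁ :=
  if x.1.head?.map Prod.fst = some C then ⟨x.1.tail, x.2.of_suffix x.1.tail_suffix⟩ else x

theorem stem_eq_self_or (C : Fin c) (x : Vertex A v₁) :
    (stem C x = x ∧ x.1.head?.map Prod.fst ≠ some C) ∨ x.1 = (C, x.last) :: (stem C x).1 := by
  obtain ⟨l, hl⟩ := x
  rcases l with _ | ⟨⟨C', u⟩, s⟩
  · left; simp [stem]
  · by_cases h : C' = C
    · right; simp [stem, h, Vertex.last, endpoint]
    · left; simp [stem, h]

theorem stem_of_cons {C : Fin c} {x : Vertex A v₁} {u : Fin n} {s : Vertex A v₁}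
    (h : x.1 = (C, u) :: s.1) : stem C x = s := by
  apply Subtype.ext
  rw [stem, if_pos (by simp [h])]
  simp [h]

theorem stem_of_head_ne {C : Fin c} {x : Vertex A v₁} (h : x.1.head?.map Prod.fst ≠ some C) :
    stem C x = x := if_neg h

theorem stem_head_ne (C : Fin c) (x : Vertex A v₁) :
    (stem C x).1.head?.map Prod.fst ≠ some C := by
  rcases stem_eq_self_or C x with ⟨h, h'⟩ | h
  · rwa [h]
  · have h2 := x.2
    rw [h] at h2
    intro h3
    rw [Option.map_eq_some_iff] at h3
    obtain ⟨q, hq, rfl⟩ := h3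
    exact h2.2.1 q hq rfl

theorem stem_stem (C : Fin c) (x : Vertex A v₁) : stem C (stem C x) = stem C x :=
  stem_of_head_ne (stem_head_ne C x)

theorem eq_stem_or_cons (C : Fin c) (x : Vertex A v₁) :
    x = stem C x ∨ x.1 = (C, x.last) :: (stem C x).1 := by
  rcases stem_eq_self_or C x with h | h
  · exact Or.inl h.1.symm
  · exact Or.inr h

theorem cons_prop {x s : Vertex A v₁} {C : Fin c} {u : Fin n} (h : x.1 = (C, u) :: s.1) :
    s.last ∈ (A C).support ∧ u ∈ (A C).support ∧ u ≠ s.last := by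
  have h2 := x.2
  rw [h] at h2
  exact h2.2.2

theorem cons_ne {x s : Vertex A v₁} {C : Fin c} {u : Fin n} (h : x.1 = (C, u) :: s.1) :
    x ≠ s := by
  rintro rfl
  simpa using congrArg List.length h

/-- An edge of type `C` joins two strings of one copy of `C` along an edge of the atom. -/
theorem isEdgeOfType_iff {C : Fin c} {x y : Vertex A v₁} :
    IsEdgeOfType C x y ↔ stem C x = stem C y ∧ (A C).Adj x.last y.last := by
  constructor
  · rintro ⟨hadj, h⟩
    refine ⟨?_, hadj⟩
    rcases h with h | h | ⟨s, h, h'⟩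
    · rw [stem_of_cons h]
      have h2 := y.2
      rw [h] at h2
      refine stem_of_head_ne fun h3 => ?_
      rw [Option.map_eq_some_iff] at h3
      obtain ⟨q, hq, rfl⟩ := h3
      exact h2.2.1 q hq rfl
    · rw [stem_of_cons h]
      have h2 := x.2
      rw [h] at h2
      refine (stem_of_head_ne fun h3 => ?_).symm
      rw [Option.map_eq_some_iff] at h3
      obtain ⟨q, hq, rfl⟩ := h3
      exact h2.2.1 q hq rfl
    · have h2 := x.2
      rw [h] at h2
      rw [stem_of_cons (s := ⟨s, h2.1⟩) h, stem_of_cons (s := ⟨s, h2.1⟩) h']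
  · rintro ⟨hs, hadj⟩
    refine ⟨hadj, ?_⟩
    rcases eq_stem_or_cons C x with h | h <;> rcases eq_stem_or_cons C y with h' | h'
    · exact absurd (congrArg Vertex.last (h.trans (hs.trans h'.symm))) hadj.ne
    · left; rw [← hs, ← h] at h'; exact h'
    · right; left; rw [hs, ← h'] at h; exact h
    · right; right; exact ⟨_, h, hs ▸ h'⟩

theorem eq_of_stem_eq {C : Fin c} {x y : Vertex A v₁} (h : stem C x = stem C y)
    (hl : x.last = y.last) : x = y := by
  rcases eq_stem_or_cons C x with h1 | h1 <;> rcases eq_stem_or_cons C y with h2 | h2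
  · rw [h1, h2, h]
  · exact absurd (by rw [← hl, ← h, ← h1]) (cons_prop h2).2.2
  · exact absurd (by rw [hl, h, ← h2]) (cons_prop h1).2.2
  · apply Subtype.ext; rw [h1, h2, hl, h]

open Classical in
/-- The vertex ending in `u` of the copy of the atom `C` through `x`, or `x` itself if the
copy has no such vertex. -/
noncomputable def move (C : Fin c) (x : Vertex A v₁) (u : Fin n) : Vertex A v₁ :=
  if h : ∃ y, stem C y = stem C x ∧ y.last = u then h.choose else x

theorem stem_move (C : Fin c) (x : Vertex A v₁) (u : Fin n) :
    stem C (move C x u) = stem C x := by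
  unfold move
  split_ifs with h
  · exact h.choose_spec.1
  · rfl

theorem move_last {C : Fin c} {x y : Vertex A v₁} (h : stem C y = stem C x) :
    move C x y.last = y := by
  have h' : ∃ y', stem C y' = stem C x ∧ y'.last = y.last := ⟨y, h, rfl⟩
  unfold move
  rw [dif_pos h']
  exact eq_of_stem_eq (h'.choose_spec.1.trans h.symm) h'.choose_spec.2

theorem last_move {C : Fin c} {x : Vertex A v₁} {u : Fin n} (hu : (A C).Reachable x.last u) :
    (move C x u).last = u := by
  suffices h : ∃ y, stem C y = stem C x ∧ y.last = u by
    unfold move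
    rw [dif_pos h]
    exact h.choose_spec.2
  by_cases hxu : x.last = u
  · exact ⟨x, rfl, hxu⟩
  have hx : x.last ∈ (A C).support ∧ u ∈ (A C).support := by
    obtain ⟨p⟩ := hu
    refine ⟨?_, ?_⟩
    · cases p with
      | nil => exact absurd rfl hxu
      | cons h _ => exact ⟨_, h⟩
    · cases p.reverse with
      | nil => exact absurd rfl hxu
      | cons h _ => exact ⟨_, h⟩
  have hs : (stem C x).last ∈ (A C).support := by
    rcases eq_stem_or_cons C x with h | h
    · rw [← h]; exact hx.1
    · exact (cons_prop h).1
  by_cases hu' : u = (stem C x).last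
  · exact ⟨stem C x, stem_stem C x, hu'.symm⟩
  · refine ⟨⟨(C, u) :: (stem C x).1, (stem C x).2, ?_, hs, hx.2, hu'⟩, stem_of_cons rfl, rfl⟩
    intro q hq hC
    exact stem_head_ne C x (by rw [Option.mem_def.mp hq]; simp [hC])

/-- The vertices of the additive product graph that a path from `k` reaches by leaving `k` along
the copy of the atom `C` through `k`. If `k` is the stem of this copy, the path lengthens the
string by a step in `C`; otherwise it drops the last step of `k`, and ends at a string that does
not extend `k`. -/
def beyond (C : Fin c) (k : Vertex A v₁) : Set (Vertex A v₁) :=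
  {y | (stem C k = k ∧ ∃ u, (C, u) :: k.1 <:+ y.1) ∨ (stem C k ≠ k ∧ ¬ k.1 <:+ y.1)}

theorem self_notMem_beyond (C : Fin c) (k : Vertex A v₁) : k ∉ beyond C k := by
  rintro (⟨_, u, h⟩ | ⟨_, h⟩)
  · simpa using h.length_le
  · exact h List.suffix_rfl

theorem beyond_disjoint {C C' : Fin c} (h : C ≠ C') {k y : Vertex A v₁} (hy : y ∈ beyond C k) :
    y ∉ beyond C' k := by
  rintro (⟨h1, u, h2⟩ | ⟨h1, h2⟩) <;> rcases hy with (⟨h3, v, h4⟩ | ⟨h3, h4⟩)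
  · have := (List.suffix_of_suffix_length_le h2 h4 (by simp)).eq_of_length (by simp)
    simp at this
    exact h this.1.symm
  · exact h4 ((List.suffix_cons _ _).trans h2)
  · exact h2 ((List.suffix_cons _ _).trans h4)
  · rcases stem_eq_self_or C k with ⟨h5, -⟩ | h5
    · exact h3 h5
    rcases stem_eq_self_or C' k with ⟨h6, -⟩ | h6
    · exact h1 h6
    rw [h5] at h6
    simp at h6
    exact h h6.1

/-- Every other vertex is reached from `k` through one of the atoms. -/
theorem exists_mem_beyond {k y : Vertex A v₁} (h : y ≠ k) : ∃ C, y ∈ beyond C k := by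
  by_cases hs : k.1 <:+ y.1
  · obtain ⟨t, ht⟩ := hs
    rcases List.eq_nil_or_concat t with rfl | ⟨t', ⟨C, u⟩, rfl⟩
    · exact absurd (Subtype.ext ht.symm) h
    · have hsuf : (C, u) :: k.1 <:+ y.1 := ⟨t', by rw [← ht]; simp⟩
      refine ⟨C, Or.inl ⟨?_, u, hsuf⟩⟩
      exact (stem_of_cons (x := ⟨_, y.2.of_suffix hsuf⟩) (s := k) rfl) ▸ stem_stem C _
  · obtain ⟨l, hl⟩ := k
    rcases l with _ | ⟨⟨C, u⟩, s⟩
    · exact absurd List.nil_suffix hs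
    · refine ⟨C, Or.inr ⟨?_, hs⟩⟩
      rw [stem_of_cons (s := ⟨s, hl.1⟩) rfl]
      exact (cons_ne (x := ⟨_, hl⟩) (s := ⟨s, hl.1⟩) rfl).symm

/-- The parts hanging at two different vertices of a copy are disjoint. -/
theorem mem_beyond_or {C : Fin c} {k k' : Vertex A v₁} (hs : stem C k = stem C k') (hne : k ≠ k')
    (y : Vertex A v₁) : y ∈ beyond C k ∨ y ∈ beyond C k' := by
  by_contra hcon
  rw [not_or] at hcon
  obtain ⟨h1, h2⟩ := hcon
  simp only [beyond, Set.mem_ofPred_eq, not_or, not_and, not_not, not_exists] at h1 h2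
  rcases eq_stem_or_cons C k with hk | hk <;> rcases eq_stem_or_cons C k' with hk' | hk'
  · exact hne (hk.trans (hs.trans hk'.symm))
  · have h3 := h2.2 (fun h => cons_ne hk' h.symm)
    rw [hk', ← hs, ← hk] at h3
    exact h1.1 hk.symm _ h3
  · have h3 := h1.2 (fun h => cons_ne hk h.symm)
    rw [hk, hs, ← hk'] at h3
    exact h2.1 hk'.symm _ h3
  · have h3 := h1.2 (fun h => cons_ne hk h.symm)
    have h4 := h2.2 (fun h => cons_ne hk' h.symm)
    have hlen : k.1.length = k'.1.length := by rw [hk, hk', hs]; simp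
    exact hne (Subtype.ext ((List.suffix_of_suffix_length_le h3 h4 hlen.le).eq_of_length hlen))

/-- An edge that leaves the set of strings extending `k` starts at `k`. -/
theorem eq_of_suffix_of_adj {C : Fin c} {k y y' : Vertex A v₁} (h : IsEdgeOfType C y y')
    (hy : k.1 <:+ y.1) (hy' : ¬ k.1 <:+ y'.1) : y = k ∧ stem C k ≠ k := by
  have key : ∀ s : Vertex A v₁, y.1 = (C, y.last) :: s.1 → ¬ k.1 <:+ s.1 →
      y = k ∧ stem C k ≠ k := by
    intro s hs hks
    rw [hs, List.suffix_cons_iff] at hy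
    rcases hy with hy | hy
    · have hyk : k = y := Subtype.ext (hy.trans hs.symm)
      refine ⟨hyk.symm, ?_⟩
      rw [hyk, stem_of_cons hs]
      exact (cons_ne hs).symm
    · exact absurd hy hks
  rcases h.2 with h | h | ⟨s, h, h'⟩
  · exact absurd (h ▸ hy.trans (List.suffix_cons _ _)) hy'
  · exact key y' h hy'
  · refine key ⟨s, y.2.of_suffix (h ▸ List.suffix_cons _ _)⟩ h fun h2 => hy' ?_
    rw [h']
    exact h2.trans (List.suffix_cons _ _)

/-- An edge that enters `beyond C k` starts at `k` and is of type `C`. -/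
theorem eq_of_adj_beyond {C E : Fin c} {k y y' : Vertex A v₁} (h : IsEdgeOfType E y y')
    (hy : y ∉ beyond C k) (hy' : y' ∈ beyond C k) : y = k ∧ E = C := by
  rcases hy' with ⟨hk, u, hu⟩ | ⟨hk, hu⟩
  · have hy2 : ∀ v, ¬ (C, v) :: k.1 <:+ y.1 := fun v hv => hy (Or.inl ⟨hk, v, hv⟩)
    have hstr := y'.2.of_suffix hu
    have hsymm : IsEdgeOfType E y' y :=
      isEdgeOfType_iff.2 ⟨(isEdgeOfType_iff.1 h).1.symm, (isEdgeOfType_iff.1 h).2.symm⟩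
    obtain ⟨h1, h2⟩ := eq_of_suffix_of_adj (k := ⟨_, hstr⟩) hsymm hu (hy2 u)
    have hEC : E = C := by
      by_contra hne
      exact h2 (stem_of_head_ne (by simpa using fun h => hne h.symm))
    subst hEC
    have h3 : stem E y' = k := stem_of_cons (by rw [h1])
    have h4 : stem E y = k := (isEdgeOfType_iff.1 h).1.trans h3
    rcases eq_stem_or_cons E y with h5 | h5
    · exact ⟨h5.trans h4, rfl⟩
    · rw [h4] at h5
      exact absurd (h5 ▸ List.suffix_rfl) (hy2 y.last)
  · have hy2 : k.1 <:+ y.1 := by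
      by_contra h2
      exact hy (Or.inr ⟨hk, h2⟩)
    obtain ⟨h1, h2⟩ := eq_of_suffix_of_adj h hy2 hu
    refine ⟨h1, ?_⟩
    rcases stem_eq_self_or C k with ⟨h5, -⟩ | h5
    · exact absurd h5 hk
    rcases stem_eq_self_or E k with ⟨h6, -⟩ | h6
    · exact absurd h6 h2
    rw [h5] at h6
    simp at h6
    exact h6.1.symm

/-- The parts of the graph reached from `k` through other atoms than `C` lie behind `k` when seen
from another vertex of its copy of `C`. -/
theorem beyond_subset_beyond {C C' : Fin c} {k x : Vertex A v₁} (hs : stem C k = stem C x)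
    (hne : k ≠ x) (hC : C' ≠ C) {y : Vertex A v₁} (hy : y ∈ beyond C' k) : y ∈ beyond C x :=
  (mem_beyond_or hs hne y).resolve_left (beyond_disjoint hC hy)

theorem mem_beyond_of_stem_eq {C : Fin c} {k x : Vertex A v₁} (hs : stem C k = stem C x)
    (hne : k ≠ x) : k ∈ beyond C x :=
  (mem_beyond_or hs hne k).resolve_left (self_notMem_beyond C k)

end AdditiveProduct

/-! ### Weighted sums over part of the spins -/

theorem DependsOn.finset_prod {V Q R ι : Type*} [CommRing R] {I : Finset ι}
    {f : ι → (V → Q) → R} {s : Set V}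
    (h : ∀ i ∈ I, DependsOn (f i) s) : DependsOn (fun z => ∏ i ∈ I, f i z) s :=
  fun _ _ hz => Finset.prod_congr rfl fun i hi => h i hi hz

section Marginal

variable {V Q R : Type*} [DecidableEq V] [Fintype Q] [CommRing R]

/-- The sum of `F` over the spins in `T` with single-spin weights `w`, the other spins being kept
at their values in `z`. -/
def marginal (w : V → Q → R) (T : Finset V) (F : (V → Q) → R) (z : V → Q) : R :=
  ∑ y : T → Q, (∏ k : T, w k (y k)) * F (Function.updateFinset z T y)

@[simp]
theorem marginal_empty (w : V → Q → R) (F : (V → Q) → R) : marginal w ∅ F = F := by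
  funext z
  simp [marginal]

theorem marginal_union (w : V → Q → R) {S T : Finset V} (h : Disjoint S T) (F : (V → Q) → R) :
    marginal w (S ∪ T) F = marginal w S (marginal w T F) := by
  funext z
  have key : ∀ (U : Finset V) (y : U → Q) (z : V → Q),
      ∏ k : U, w k (y k) = ∏ k ∈ U, w k (Function.updateFinset z U y k) := by
    intro U y z
    rw [← Finset.prod_coe_sort U]
    exact Finset.prod_congr rfl fun k _ => by simp [Function.updateFinset]
  have h1 : ∀ y : S → Q, ∀ y' : T → Q,
      ∏ k : ↥(S ∪ T), w k (Equiv.piFinsetUnion (fun _ : V => Q) h (y, y') k) =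
        (∏ k : S, w k (y k)) * ∏ k : T, w k (y' k) := by
    intro y y'
    rw [key _ _ z, ← Function.updateFinset_updateFinset, Finset.prod_union h, key T y' _,
      key S y z]
    congr 1
    refine Finset.prod_congr rfl fun k hk => ?_
    have : k ∉ T := Finset.disjoint_left.mp h hk
    simp only [Function.updateFinset, this, dite_false]
  simp only [marginal, Finset.mul_sum]
  rw [← Fintype.sum_prod_type', ← Equiv.sum_comp (Equiv.piFinsetUnion (fun _ : V => Q) h)]
  refine Finset.sum_congr rfl fun y _ => ?_
  rw [h1, Function.updateFinset_updateFinset h, mul_assoc]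

theorem DependsOn.marginal {w : V → Q → R} {T : Finset V} {F : (V → Q) → R} {s : Set V}
    (hF : DependsOn F s) : DependsOn (marginal w T F) (s \ T) := by
  intro z z' h
  refine Finset.sum_congr rfl fun y _ => ?_
  exact congrArg _ (hF.updateFinset y h)

/-- A factor that does not depend on the summed spins can be pulled out. -/
theorem marginal_mul_left (w : V → Q → R) {T : Finset V} {f : (V → Q) → R} {s : Set V}
    (hf : DependsOn f s) (hs : Disjoint s T) (F : (V → Q) → R) :
    marginal w T (fun z => f z * F z) = fun z => f z * marginal w T F z := by
  funext z
  rw [marginal, marginal, Finset.mul_sum]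
  refine Finset.sum_congr rfl fun y _ => ?_
  rw [show f (Function.updateFinset z T y) = f z from hf fun i hi => ?_]
  · ring
  · have : i ∉ T := fun hT => Set.disjoint_left.mp hs hi hT
    simp [Function.updateFinset, this]

/-- Sums over disjoint sets of spins factor if each factor depends on one of the sets only, apart
from spins that are not summed. -/
theorem marginal_biUnion {ι : Type*} [DecidableEq ι] (w : V → Q → R) (I : Finset ι)
    (T : ι → Finset V) (F : ι → (V → Q) → R) (K : Set V)
    (hT : ∀ i ∈ I, ∀ j ∈ I, i ≠ j → Disjoint (T i) (T j)) (hK : ∀ i ∈ I, Disjoint K (T i))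
    (hF : ∀ i ∈ I, DependsOn (F i) (K ∪ T i)) :
    marginal w (I.biUnion T) (fun z => ∏ i ∈ I, F i z) =
      fun z => ∏ i ∈ I, marginal w (T i) (F i) z := by
  induction I using Finset.induction_on with
  | empty => simp
  | insert i I hi ih =>
    have hTi : ∀ j ∈ I, Disjoint (T i) (T j) := fun j hj =>
      hT i (by simp) j (by simp [hj]) (by rintro rfl; exact hi hj)
    have hdisj : Disjoint (T i) (I.biUnion T) := by
      rw [Finset.disjoint_biUnion_right]
      exact hTi
    have ih' := ih (fun i hi j hj => hT i (by simp [hi]) j (by simp [hj]))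
      (fun i hi => hK i (by simp [hi])) (fun i hi => hF i (by simp [hi]))
    rw [Finset.biUnion_insert, marginal_union w hdisj]
    simp only [Finset.prod_insert hi]
    rw [marginal_mul_left w (hF i (by simp)), ih']
    · funext z
      have : (fun z => F i z * ∏ i ∈ I, marginal w (T i) (F i) z) =
          fun z => (∏ i ∈ I, marginal w (T i) (F i) z) * F i z := by funext z; ring
      rw [this, marginal_mul_left w (f := fun z => ∏ i ∈ I, marginal w (T i) (F i) z) (s := K),
        mul_comm]
      · refine DependsOn.finset_prod fun j hj => (hF j (by simp [hj])).marginal.mono ?_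
        simp
      · exact hK i (by simp)
    · rw [Set.disjoint_union_left]
      refine ⟨?_, by exact_mod_cast hdisj⟩
      rw [Finset.coe_biUnion, Set.disjoint_iUnion₂_right]
      exact fun j hj => hK j (by simp [Finset.mem_coe.mp hj])

end Marginal

section EdgeProd

variable {V Q R : Type*}

open Classical in
/-- The edges of `H` with both ends in `T`. -/
noncomputable def SimpleGraph.edgesIn (H : SimpleGraph V) (T : Finset V) : Finset (Sym2 V) :=
  T.sym2.filter (· ∈ H.edgeSet)

theorem SimpleGraph.mem_edgesIn {H : SimpleGraph V} {T : Finset V} {e : Sym2 V} :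
    e ∈ H.edgesIn T ↔ (∀ x ∈ e, x ∈ T) ∧ e ∈ H.edgeSet := by
  simp [SimpleGraph.edgesIn, Finset.mem_sym2_iff]

/-- The product of the edge factors `φ` over the edges of `H` with both ends in `T`. -/
noncomputable def edgeProd [CommRing R] (φ : Sym2 Q → R) (H : SimpleGraph V) (T : Finset V)
    (z : V → Q) : R :=
  ∏ e ∈ H.edgesIn T, φ (e.map z)

theorem dependsOn_sym2_map (φ : Sym2 Q → R) {T : Set V} {e : Sym2 V} (he : ∀ x ∈ e, x ∈ T) :
    DependsOn (fun z : V → Q => φ (e.map z)) T := by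
  intro z z' h
  show φ _ = φ _
  congr 1
  exact Sym2.map_congr fun x hx => h x (he x hx)

theorem dependsOn_edgeProd [CommRing R] (φ : Sym2 Q → R) (H : SimpleGraph V) (T : Finset V) :
    DependsOn (edgeProd φ H T) (T : Set V) :=
  DependsOn.finset_prod fun _ he =>
    dependsOn_sym2_map φ fun x hx => (SimpleGraph.mem_edgesIn.1 he).1 x hx

/-- Gluing: if the sets `T i` are disjoint and each of them is attached to a core `K` only at the
vertex `r i`, then summing the spins of all `T i` gives independent factors. -/
theorem marginal_glue [DecidableEq V] [CommRing R] [Fintype Q] {ι : Type*} [DecidableEq ι]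
    (w : V → Q → R) (φ : Sym2 Q → R)
    (H : SimpleGraph V) (K : Finset V) (I : Finset ι) (T : ι → Finset V) (r : ι → V)
    (hr : ∀ i ∈ I, r i ∈ K) (hT : ∀ i ∈ I, ∀ j ∈ I, i ≠ j → Disjoint (T i) (T j))
    (hK : ∀ i ∈ I, Disjoint K (T i))
    (hE : ∀ x y, H.Adj x y → ∀ i ∈ I, x ∈ T i → y ∈ K ∪ I.biUnion T → y = r i ∨ y ∈ T i) :
    marginal w (I.biUnion T) (edgeProd φ H (K ∪ I.biUnion T)) = fun z =>
      edgeProd φ H K z * ∏ i ∈ I, marginal w (T i) (edgeProd φ H (insert (r i) (T i))) z := by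
  classical
  -- An edge inside `insert (r i) (T i)` has an end in `T i`, as it is not a loop.
  have hend : ∀ i, ∀ e ∈ H.edgesIn (insert (r i) (T i)), ∃ x ∈ e, x ∈ T i := by
    intro i e he
    rw [SimpleGraph.mem_edgesIn] at he
    induction e with
    | _ x y =>
      have h1 := he.1 x (by simp)
      have h2 := he.1 y (by simp)
      rw [Finset.mem_insert] at h1 h2
      rcases h1 with h1 | h1
      · rcases h2 with h2 | h2
        · exact absurd (h1.trans h2.symm) (SimpleGraph.mem_edgeSet _ |>.1 he.2).ne
        · exact ⟨y, by simp, h2⟩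
      · exact ⟨x, by simp, h1⟩
  have hsplit : H.edgesIn (K ∪ I.biUnion T) =
      H.edgesIn K ∪ I.biUnion fun i => H.edgesIn (insert (r i) (T i)) := by
    ext e
    simp only [Finset.mem_union, Finset.mem_biUnion, SimpleGraph.mem_edgesIn]
    constructor
    · rintro ⟨h1, h2⟩
      by_cases hall : ∀ x ∈ e, x ∈ K
      · exact Or.inl ⟨hall, h2⟩
      push Not at hall
      obtain ⟨x, hx, hxK⟩ := hall
      obtain ⟨i, hi, hxi⟩ := (h1 x hx).resolve_left hxK
      obtain ⟨y, rfl⟩ := Sym2.mem_iff_exists.1 hx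
      refine Or.inr ⟨i, hi, ?_, h2⟩
      intro u hu
      rw [Sym2.mem_iff] at hu
      rcases hu with rfl | rfl
      · simp [hxi]
      · rw [Finset.mem_insert]
        exact hE x u h2 i hi hxi (by simpa using h1 u (by simp))
    · rintro (⟨h1, h2⟩ | ⟨i, hi, h1, h2⟩)
      · exact ⟨fun x hx => Or.inl (h1 x hx), h2⟩
      · refine ⟨fun x hx => ?_, h2⟩
        rcases Finset.mem_insert.1 (h1 x hx) with rfl | h
        · exact Or.inl (hr i hi)
        · exact Or.inr ⟨i, hi, h⟩
  have hfac : edgeProd φ H (K ∪ I.biUnion T) = fun z =>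
      edgeProd φ H K z * ∏ i ∈ I, edgeProd φ H (insert (r i) (T i)) z := by
    funext z
    simp only [edgeProd]
    rw [hsplit, Finset.prod_union, Finset.prod_biUnion]
    · intro i hi j hj hij
      rw [Function.onFun, Finset.disjoint_left]
      intro e he he'
      obtain ⟨x, hx, hxi⟩ := hend i e he
      rcases Finset.mem_insert.1 ((SimpleGraph.mem_edgesIn.1 he').1 x hx) with rfl | h
      · exact Finset.disjoint_left.1 (hK i hi) (hr j hj) hxi
      · exact Finset.disjoint_left.1 (hT i hi j hj hij) hxi h
    · rw [Finset.disjoint_biUnion_right]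
      intro i hi
      rw [Finset.disjoint_left]
      intro e he he'
      obtain ⟨x, hx, hxi⟩ := hend i e he'
      exact Finset.disjoint_left.1 (hK i hi) ((SimpleGraph.mem_edgesIn.1 he).1 x hx) hxi
  rw [hfac, marginal_mul_left w (dependsOn_edgeProd φ H K),
    marginal_biUnion w I T _ (K : Set V) hT]
  · exact fun i hi => by exact_mod_cast hK i hi
  · intro i hi
    refine (dependsOn_edgeProd φ H _).mono ?_
    intro x hx
    rcases Finset.mem_insert.1 (Finset.mem_coe.1 hx) with rfl | h
    · exact Or.inl (hr i hi)
    · exact Or.inr h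
  · rw [Finset.coe_biUnion, Set.disjoint_iUnion₂_right]
    exact fun i hi => by exact_mod_cast hK i hi

end EdgeProd

/-! ### Branches of the additive product graph -/

namespace AdditiveProduct

variable {n c : ℕ} {A : Fin c → SimpleGraph (Fin n)} {v₁ : Fin n}

theorem _root_.SimpleGraph.reachable_of_mem_nbhd {H : SimpleGraph (Fin n)} {a u : Fin n} {m : ℕ}
    (h : u ∈ H.nbhd {a} m) : H.Reachable a u := by
  obtain ⟨t, rfl, ht⟩ := h
  exact SimpleGraph.reachable_of_edist_ne_top (ne_top_of_le_ne_top (ENat.natCast_ne_top m) ht)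

theorem _root_.SimpleGraph.mem_nbhd_singleton_iff {H : SimpleGraph (Fin n)} {a u : Fin n} {m : ℕ} :
    u ∈ H.nbhd {a} m ↔ H.Reachable a u ∧ H.dist u a ≤ m := by
  constructor
  · intro h
    have hr := SimpleGraph.reachable_of_mem_nbhd h
    obtain ⟨t, rfl, ht⟩ := h
    refine ⟨hr, ?_⟩
    rw [SimpleGraph.dist_comm]
    rwa [← hr.coe_dist_eq_edist, Nat.cast_le] at ht
  · rintro ⟨hr, h⟩
    refine ⟨a, rfl, ?_⟩
    rw [← hr.coe_dist_eq_edist, Nat.cast_le, SimpleGraph.dist_comm]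
    exact h

theorem _root_.SimpleGraph.dist_pos_of_mem_nbhd {H : SimpleGraph (Fin n)} {a u : Fin n} {m : ℕ}
    (h : u ∈ H.nbhd {a} m) (hne : u ≠ a) : 0 < H.dist u a :=
  (SimpleGraph.reachable_of_mem_nbhd h).symm.pos_dist_of_ne hne

open Classical in
/-- The vertices other than `x` that a path from `x` of length at most `m` reaches by leaving `x`
along the copy of the atom `C` through `x`. The recursion is that of `HamQAOA.branchSum`: within
the copy one moves to some vertex `u`, and continues from there through other atoms. -/
noncomputable def branch (C : Fin c) (x : Vertex A v₁) (m : ℕ) : Finset (Vertex A v₁) :=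
  (Finset.univ : Finset {u : Fin n // u ∈ (A C).nbhd {x.last} m ∧ u ≠ x.last}).biUnion fun u =>
    insert (move C x u.1) ((Finset.univ.erase C).biUnion fun C' =>
      branch C' (move C x u.1) (m - (A C).dist u.1 x.last))
termination_by m
decreasing_by
  have h := SimpleGraph.dist_pos_of_mem_nbhd u.2.1 u.2.2
  have h' := (SimpleGraph.mem_nbhd_singleton_iff.1 u.2.1).2
  omega

theorem mem_branch {C : Fin c} {x y : Vertex A v₁} {m : ℕ} :
    y ∈ branch C x m ↔ ∃ u, u ∈ (A C).nbhd {x.last} m ∧ u ≠ x.last ∧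
      (y = move C x u ∨ ∃ C', C' ≠ C ∧
        y ∈ branch C' (move C x u) (m - (A C).dist u x.last)) := by
  rw [branch]
  simp [and_assoc]

theorem move_ne {C : Fin c} {x : Vertex A v₁} {u : Fin n} (hu : (A C).Reachable x.last u)
    (hne : u ≠ x.last) : move C x u ≠ x := by
  intro h
  exact hne (by rw [← h, last_move hu])

theorem move_self (C : Fin c) (x : Vertex A v₁) : move C x x.last = x := move_last rfl

theorem move_inj {C : Fin c} {x : Vertex A v₁} {u v : Fin n} (hu : (A C).Reachable x.last u)
    (hv : (A C).Reachable x.last v) (h : move C x u = move C x v) : u = v := by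
  rw [← last_move hu, h, last_move hv]

theorem branch_subset_beyond {C : Fin c} {x y : Vertex A v₁} {m : ℕ} (h : y ∈ branch C x m) :
    y ∈ beyond C x := by
  induction m using Nat.strong_induction_on generalizing C x with
  | _ m ih =>
    obtain ⟨u, hu, hne, h⟩ := mem_branch.1 h
    have hr := SimpleGraph.reachable_of_mem_nbhd hu
    rcases h with rfl | ⟨C', hC', h⟩
    · exact mem_beyond_of_stem_eq (stem_move _ _ _) (move_ne hr hne)
    · have h0 := SimpleGraph.dist_pos_of_mem_nbhd hu hne
      have h1 := (SimpleGraph.mem_nbhd_singleton_iff.1 hu).2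
      exact beyond_subset_beyond (stem_move _ _ _) (move_ne hr hne) hC' (ih _ (by omega) h)

theorem IsEdgeOfType.symm {C : Fin c} {x y : Vertex A v₁} (h : IsEdgeOfType C x y) :
    IsEdgeOfType C y x :=
  isEdgeOfType_iff.2 ⟨(isEdgeOfType_iff.1 h).1.symm, (isEdgeOfType_iff.1 h).2.symm⟩

theorem _root_.SimpleGraph.nbhd_succ_of_adj {W : Type*} {H : SimpleGraph W} {T : Set W} {u v : W}
    {m : ℕ}
    (hu : u ∈ H.nbhd T m) (huv : H.Adj u v) : v ∈ H.nbhd T (m + 1) := by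
  obtain ⟨t, ht, h⟩ := hu
  refine ⟨t, ht, (SimpleGraph.edist_triangle (v := u)).trans ?_⟩
  rw [SimpleGraph.edist_eq_one_iff_adj.2 huv]
  push_cast
  gcongr

theorem _root_.SimpleGraph.nbhd_mono {W : Type*} {H : SimpleGraph W} {T : Set W} {m m' : ℕ}
    (h : m ≤ m') :
    H.nbhd T m ⊆ H.nbhd T m' := by
  rintro u ⟨t, ht, h'⟩
  exact ⟨t, ht, h'.trans (by exact_mod_cast h)⟩

/-- A path that has stayed in a branch for `m` steps, and then steps to another vertex behind
`x`, stays in the branch. -/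
theorem branch_step {C E : Fin c} {x y y' : Vertex A v₁} {m : ℕ}
    (hy : y = x ∨ y ∈ branch C x m) (hE : IsEdgeOfType E y y') (hy' : y' ∈ beyond C x) :
    y' ∈ branch C x (m + 1) := by
  induction m using Nat.strong_induction_on generalizing C x y y' E with
  | _ m ih =>
    rcases hy with rfl | hy
    · obtain ⟨-, rfl⟩ := eq_of_adj_beyond hE (self_notMem_beyond C y) hy'
      rw [isEdgeOfType_iff] at hE
      refine mem_branch.2 ⟨y'.last, ⟨_, rfl, ?_⟩, hE.2.ne', Or.inl (move_last hE.1.symm).symm⟩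
      rw [SimpleGraph.edist_eq_one_iff_adj.2 hE.2]
      simp
    obtain ⟨u, hu, hne, h⟩ := mem_branch.1 hy
    have hr := SimpleGraph.reachable_of_mem_nbhd hu
    have h0 := SimpleGraph.dist_pos_of_mem_nbhd hu hne
    have h1 := (SimpleGraph.mem_nbhd_singleton_iff.1 hu).2
    have hu' := SimpleGraph.nbhd_mono (Nat.le_succ m) hu
    set k := move C x u with hk
    have hstem : stem C k = stem C x := stem_move _ _ _
    have hyk : y ∉ beyond C k := by
      rcases h with rfl | ⟨C', hC', h⟩
      · exact self_notMem_beyond _ _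
      · exact beyond_disjoint hC' (branch_subset_beyond h)
    by_cases hk' : y' ∈ beyond C k
    · obtain ⟨rfl, rfl⟩ := eq_of_adj_beyond hE hyk hk'
      rw [isEdgeOfType_iff] at hE
      have hlast : k.last = u := last_move hr
      refine mem_branch.2 ⟨y'.last, SimpleGraph.nbhd_succ_of_adj (hlast ▸ hu) hE.2, ?_, Or.inl
        (move_last (hE.1.symm.trans hstem)).symm⟩
      intro hcon
      exact self_notMem_beyond E x (eq_of_stem_eq (hE.1.symm.trans hstem) hcon ▸ hy')
    · by_cases hyk' : y' = k
      · exact mem_branch.2 ⟨u, hu', hne, Or.inl hyk'⟩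
      obtain ⟨C', hC'⟩ := exists_mem_beyond hyk'
      have hne' : C' ≠ C := by rintro rfl; exact hk' hC'
      refine mem_branch.2 ⟨u, hu', hne, Or.inr ⟨C', hne', ?_⟩⟩
      rw [Nat.sub_add_comm h1]
      refine ih _ (by omega) ?_ hE hC'
      rcases h with h | ⟨C'', hC'', h⟩
      · exact Or.inl h
      · right
        have : C'' = C' := by
          by_contra hcc
          have := branch_subset_beyond h
          have h4 := (eq_of_adj_beyond (IsEdgeOfType.symm hE)
            (beyond_disjoint (Ne.symm hcc) hC') this).1
          exact hyk' h4
        exact this ▸ h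

/-! ### Finite neighbourhoods of an edge -/

open Classical in
/-- The copies of the vertices in `N` in the copy of the atom `C` through `x`. -/
noncomputable def copyOf (C : Fin c) (x : Vertex A v₁) (N : Finset (Fin n)) :
    Finset (Vertex A v₁) := N.image (move C x)

open Classical in
/-- The union of the branches that leave the copy of `C` through `x` at the copies of the vertices
`u ∈ N`, where the branches at the copy of `u` have depth `D u`. -/
noncomputable def hanging (C : Fin c) (x : Vertex A v₁) (N : Finset (Fin n)) (D : Fin n → ℕ) :
    Finset (Vertex A v₁) :=
  (N ×ˢ Finset.univ.erase C).biUnion fun i => branch i.2 (move C x i.1) (D i.1)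

theorem mem_hanging {C : Fin c} {x y : Vertex A v₁} {N : Finset (Fin n)} {D : Fin n → ℕ} :
    y ∈ hanging C x N D ↔ ∃ u ∈ N, ∃ C', C' ≠ C ∧ y ∈ branch C' (move C x u) (D u) := by
  simp [hanging]

/-- The copy of `C` meets what hangs at one of its vertices only in this vertex. -/
theorem notMem_beyond_of_stem_eq {C C' : Fin c} {x k : Vertex A v₁} (hs : stem C x = stem C k)
    (hC : C' ≠ C) : x ∉ beyond C' k := by
  by_cases h : x = k
  · rw [h]; exact self_notMem_beyond _ _
  · exact beyond_disjoint hC.symm (mem_beyond_of_stem_eq hs h)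

theorem hanging_disjoint {C C' C'' : Fin c} {x y : Vertex A v₁} {u v : Fin n}
    (hu : (A C).Reachable x.last u) (hv : (A C).Reachable x.last v) (hC' : C' ≠ C)
    (hC'' : C'' ≠ C) (hne : (u, C') ≠ (v, C'')) (hy : y ∈ beyond C' (move C x u)) :
    y ∉ beyond C'' (move C x v) := by
  by_cases huv : u = v
  · subst huv
    exact beyond_disjoint (by rintro rfl; exact hne rfl) hy
  · exact beyond_disjoint hC''.symm (beyond_subset_beyond ((stem_move _ _ _).trans
      (stem_move _ _ _).symm) (fun h => huv (move_inj hu hv h)) hC' hy)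

theorem disjoint_copyOf_hanging {C : Fin c} {x : Vertex A v₁} {N N' : Finset (Fin n)}
    {D : Fin n → ℕ} : Disjoint (copyOf C x N) (hanging C x N' D) := by
  classical
  rw [Finset.disjoint_left]
  intro y hy hy'
  obtain ⟨v, -, rfl⟩ := Finset.mem_image.1 hy
  obtain ⟨u, -, C', hC', h⟩ := mem_hanging.1 hy'
  exact notMem_beyond_of_stem_eq ((stem_move _ _ _).trans (stem_move _ _ _).symm) hC'
    (branch_subset_beyond h)

/-- Summing the spins of all hanging branches leaves the copy of the atom `C`, with one factor
for each branch. -/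
theorem marginal_hanging {Q R : Type*} [Fintype Q] [CommRing R] (w : Vertex A v₁ → Q → R)
    (φ : Sym2 Q → R) {C : Fin c} {x : Vertex A v₁} {N N' : Finset (Fin n)} {D : Fin n → ℕ}
    (hN : ∀ u ∈ N, (A C).Reachable x.last u) (hN' : N' ⊆ N) :
    marginal w (hanging C x N' D)
      (edgeProd φ (graph A v₁) (copyOf C x N ∪ hanging C x N' D)) = fun z =>
      edgeProd φ (graph A v₁) (copyOf C x N) z * ∏ u ∈ N', ∏ C' ∈ Finset.univ.erase C,
        marginal w (branch C' (move C x u) (D u)) (edgeProd φ (graph A v₁)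
          (insert (move C x u) (branch C' (move C x u) (D u)))) z := by
  classical
  have h := marginal_glue w φ (graph A v₁) (copyOf C x N) (N' ×ˢ Finset.univ.erase C)
    (fun i => branch i.2 (move C x i.1) (D i.1)) (fun i => move C x i.1) ?_ ?_ ?_ ?_
  · simp only [Finset.prod_product] at h
    convert h using 1
    all_goals simp [hanging]
  · intro i hi
    exact Finset.mem_image_of_mem _ (hN' (Finset.mem_product.1 hi).1)
  · intro i hi j hj hij
    simp only [Finset.mem_product, Finset.mem_erase, Finset.mem_univ, and_true] at hi hj
    rw [Finset.disjoint_left]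
    intro y hy hy'
    exact hanging_disjoint (hN _ (hN' hi.1)) (hN _ (hN' hj.1)) hi.2 hj.2 hij
      (branch_subset_beyond hy) (branch_subset_beyond hy')
  · intro i hi
    refine Finset.disjoint_of_subset_right ?_ (disjoint_copyOf_hanging (N' := N') (D := D))
    exact Finset.subset_biUnion_of_mem (fun i => branch i.2 (move C x i.1) (D i.1)) hi
  · rintro s y ⟨E, hE⟩ i hi hs hy
    simp only [Finset.mem_product, Finset.mem_erase, Finset.mem_univ, and_true] at hi
    by_cases hyb : y ∈ beyond i.2 (move C x i.1)
    · right
      rcases Finset.mem_union.1 hy with hy | hy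
      · obtain ⟨v, -, rfl⟩ := Finset.mem_image.1 hy
        exact absurd hyb (notMem_beyond_of_stem_eq
          ((stem_move _ _ _).trans (stem_move _ _ _).symm) hi.2)
      · obtain ⟨j, hj, hyj⟩ := Finset.mem_biUnion.1 hy
        simp only [Finset.mem_product, Finset.mem_erase, Finset.mem_univ, and_true] at hj
        by_cases hij : j = i
        · exact hij ▸ hyj
        · exact absurd hyb (hanging_disjoint (hN _ (hN' hj.1)) (hN _ (hN' hi.1)) hj.2 hi.2 hij
            (branch_subset_beyond hyj))
    · exact Or.inl (eq_of_adj_beyond (IsEdgeOfType.symm hE) hyb (branch_subset_beyond hs)).1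

theorem adj_move_iff {C : Fin c} {x : Vertex A v₁} {u v : Fin n}
    (hu : (A C).Reachable x.last u) (hv : (A C).Reachable x.last v) :
    (graph A v₁).Adj (move C x u) (move C x v) ↔ (A C).Adj u v := by
  have hs : stem C (move C x u) = stem C (move C x v) :=
    (stem_move _ _ _).trans (stem_move _ _ _).symm
  constructor
  · rintro ⟨E, hE⟩
    have hne : move C x v ≠ move C x u := fun h => (isEdgeOfType_iff.1 hE).2.ne (by rw [h])
    obtain ⟨-, rfl⟩ := eq_of_adj_beyond hE (self_notMem_beyond C _)
      (mem_beyond_of_stem_eq hs.symm hne)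
    have := (isEdgeOfType_iff.1 hE).2
    rwa [last_move hu, last_move hv] at this
  · intro h
    refine ⟨C, isEdgeOfType_iff.2 ⟨hs, ?_⟩⟩
    rwa [last_move hu, last_move hv]

end AdditiveProduct

/-! ### The iterative formula as a sum over a neighbourhood -/

namespace HamQAOA

open AdditiveProduct

variable {n c p : ℕ} {A : Fin c → SimpleGraph (Fin n)} {v₁ : Fin n}

/-- The phase `exp(i 𝒜 · zz')` of an edge whose ends carry the configurations `z`, `z'`. -/
noncomputable def edgeFactor (Θ : Angles p) (e : Sym2 (Config p)) : ℂ :=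
  Complex.exp (Complex.I * ((∑ i, paramVec Θ i *
    ((((e.map fun ζ => ζ i).mul : ℤˣ) : ℤ) : ℝ) : ℝ) : ℂ))

open Classical in
theorem edgePhase_eq_prod {W : Type*} [Fintype W] (Θ : Angles p) (H : SimpleGraph W)
    (z : W → Config p) :
    edgePhase Θ H z = ∏ e ∈ H.edgeFinset, edgeFactor Θ (e.map z) := by
  simp only [edgeFactor, edgePhase]
  rw [← Complex.exp_sum, ← Finset.mul_sum, ← Complex.ofReal_sum, Finset.sum_comm]
  simp only [Finset.mul_sum, Sym2.map_map]
  rfl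

theorem edgeProd_eq_edgePhase {V W : Type*} [DecidableEq V] [Fintype W] (Θ : Angles p)
    (H : SimpleGraph V) (H' : SimpleGraph W) (g : W → V) (hg : Function.Injective g)
    (hadj : ∀ u v, H.Adj (g u) (g v) ↔ H'.Adj u v) (T : Finset V)
    (hT : ∀ v, v ∈ T ↔ ∃ u, g u = v) (z : V → Config p) :
    edgeProd (edgeFactor Θ) H T z = edgePhase Θ H' (fun u => z (g u)) := by
  classical
  rw [edgePhase_eq_prod, edgeProd]
  have : H.edgesIn T = H'.edgeFinset.image (Sym2.map g) := by
    ext e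
    rw [SimpleGraph.mem_edgesIn, Finset.mem_image]
    constructor
    · rintro ⟨h1, h2⟩
      induction e with
      | _ x y =>
        obtain ⟨u, rfl⟩ := (hT x).1 (h1 x (by simp))
        obtain ⟨v, rfl⟩ := (hT y).1 (h1 y (by simp))
        exact ⟨s(u, v), by simpa using (hadj u v).1 h2, rfl⟩
    · rintro ⟨e', he', rfl⟩
      induction e' with
      | _ u v =>
        refine ⟨?_, ?_⟩
        · intro x hx
          rw [Sym2.map_mk, Sym2.mem_iff] at hx
          rcases hx with rfl | rfl
          · exact (hT _).2 ⟨_, rfl⟩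
          · exact (hT _).2 ⟨_, rfl⟩
        · simpa [hadj] using he'
  rw [this, Finset.prod_image (fun _ _ _ _ h => Sym2.map.injective hg h)]
  refine Finset.prod_congr rfl fun e _ => ?_
  rw [Sym2.map_map]
  rfl

open Classical in
theorem edgeProd_copyOf (Θ : Angles p) {C : Fin c} {x : Vertex A v₁} {N : Set (Fin n)}
    (hN : ∀ u ∈ N, (A C).Reachable x.last u) (z : Vertex A v₁ → Config p) :
    edgeProd (edgeFactor Θ) (graph A v₁) (copyOf C x N.toFinset) z =
      edgePhase Θ ((A C).induce N) (fun u => z (move C x u.1)) := by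
  refine edgeProd_eq_edgePhase Θ (graph A v₁) ((A C).induce N) (fun u => move C x u.1) ?_ ?_ _ ?_ z
  · intro u v h
    exact Subtype.ext (move_inj (hN _ u.2) (hN _ v.2) h)
  · intro u v
    exact adj_move_iff (hN _ u.2) (hN _ v.2)
  · intro v
    simp [copyOf]

variable (μ : MeasureTheory.Measure (Direction × Direction))

/-- The sum over the spins of a branch is the branch sum of the atom. -/
theorem marginal_branch (Θ : Angles p) (w : Vertex A v₁ → Config p → ℂ) {m : ℕ} {C : Fin c}
    {x : Vertex A v₁} (hw : ∀ y ∈ branch C x m, w y = vertexWeight μ Θ 1)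
    (z : Vertex A v₁ → Config p) :
    marginal w (branch C x m) (edgeProd (edgeFactor Θ) (graph A v₁) (insert x (branch C x m))) z =
      branchSum μ Θ A m C x.last (z x) := by
  classical
  induction m using Nat.strong_induction_on generalizing C x z with
  | _ m ih =>
    set a := x.last with ha
    set N : Set (Fin n) := (A C).nbhd {a} m with hNdef
    set N' : Set (Fin n) := {u | u ∈ N ∧ u ≠ a} with hN'def
    set D : Fin n → ℕ := fun u => m - (A C).dist u a with hD
    have hxa : move C x a = x := move_self C x
    have haN : a ∈ N := (A C).mem_nbhd_of_mem m rfl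
    have hr : ∀ u ∈ N, (A C).Reachable a u := fun u hu => SimpleGraph.reachable_of_mem_nbhd hu
    have hsub : N'.toFinset ⊆ N.toFinset := by
      intro u hu
      simp only [Set.mem_toFinset] at hu ⊢
      exact hu.1
    have hbranch : branch C x m = copyOf C x N'.toFinset ∪ hanging C x N'.toFinset D := by
      ext y
      rw [mem_branch, Finset.mem_union, mem_hanging, copyOf, Finset.mem_image]
      constructor
      · rintro ⟨u, hu, hne, h | ⟨C', hC', h⟩⟩
        · exact Or.inl ⟨u, Set.mem_toFinset.2 ⟨hu, hne⟩, h.symm⟩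
        · exact Or.inr ⟨u, Set.mem_toFinset.2 ⟨hu, hne⟩, C', hC', h⟩
      · rintro (⟨u, hu, h⟩ | ⟨u, hu, C', hC', h⟩)
        · rw [Set.mem_toFinset] at hu
          exact ⟨u, hu.1, hu.2, Or.inl h.symm⟩
        · rw [Set.mem_toFinset] at hu
          exact ⟨u, hu.1, hu.2, Or.inr ⟨C', hC', h⟩⟩
    have hinsert : insert x (branch C x m) =
        copyOf C x N.toFinset ∪ hanging C x N'.toFinset D := by
      rw [hbranch, ← Finset.insert_union]
      congr 1
      have : N.toFinset = insert a N'.toFinset := by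
        ext u
        simp only [Set.mem_toFinset, Finset.mem_insert, hN'def, Set.mem_ofPred_eq]
        by_cases hu : u = a
        · simp [hu, haN]
        · simp [hu]
      rw [this, copyOf, copyOf, Finset.image_insert, hxa]
    have hprod : ∀ z : Vertex A v₁ → Config p, ∏ u ∈ N'.toFinset, ∏ C' ∈ Finset.univ.erase C,
        marginal w (branch C' (move C x u) (D u)) (edgeProd (edgeFactor Θ) (graph A v₁)
          (insert (move C x u) (branch C' (move C x u) (D u)))) z =
        ∏ u ∈ N'.toFinset, ∏ C' ∈ Finset.univ.erase C, branchSum μ Θ A (D u) C' u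
          (z (move C x u)) := by
      intro z
      refine Finset.prod_congr rfl fun u hu => Finset.prod_congr rfl fun C' hC' => ?_
      have hu' := Set.mem_toFinset.1 hu
      have h0 := SimpleGraph.dist_pos_of_mem_nbhd hu'.1 hu'.2
      have h1 := (SimpleGraph.mem_nbhd_singleton_iff.1 hu'.1).2
      rw [ih (D u) (by simp only [hD]; omega), last_move (hr u hu'.1)]
      intro y hy
      refine hw y ?_
      rw [hbranch, Finset.mem_union]
      exact Or.inr (mem_hanging.2 ⟨u, hu, C', (Finset.mem_erase.1 hC').1, hy⟩)
    have hmoveN' : ∀ u : {k : N // k.1 ≠ a}, move C x u.1.1 ∈ copyOf C x N'.toFinset := fun u =>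
      Finset.mem_image_of_mem _ (Set.mem_toFinset.2 ⟨u.1.2, u.2⟩)
    have hnotx : x ∉ copyOf C x N'.toFinset := by
      intro hx
      obtain ⟨u, hu, h⟩ := Finset.mem_image.1 hx
      rw [Set.mem_toFinset] at hu
      exact move_ne (hr u hu.1) hu.2 h
    rw [hinsert, hbranch, marginal_union w disjoint_copyOf_hanging,
      marginal_hanging w _ (by simpa using hr) hsub, branchSum, marginal]
    simp only [hprod, edgeProd_copyOf Θ hr]
    -- Spins on the other vertices of the copy correspond to configurations on `N` whose value at
    -- `a` is `z x`.
    refine Finset.sum_bij'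
      (fun y _ => fun u : N => Function.updateFinset z (copyOf C x N'.toFinset) y (move C x u.1))
      (fun ζ _ => fun k => if h : k.1.last ∈ N then ζ ⟨k.1.last, h⟩ else z x) ?_ ?_ ?_ ?_ ?_
    · intro y _
      simp only [Finset.mem_filter, Finset.mem_univ, true_and]
      rw [hxa]
      simp only [Function.updateFinset, hnotx, dite_false]
    · intro ζ _
      exact Finset.mem_univ _
    · intro y _
      funext k
      obtain ⟨u, hu, hk⟩ := Finset.mem_image.1 k.2
      have hu' := Set.mem_toFinset.1 hu
      have hlast : k.1.last = u := by rw [← hk, last_move (hr u hu'.1)]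
      have hkN : k.1.last ∈ N := hlast ▸ hu'.1
      rw [dif_pos hkN]
      simp only [hlast, hk, Function.updateFinset, k.2, dite_true]
    · intro ζ hζ
      funext u
      by_cases hu : u.1 = a
      · rw [Finset.mem_filter] at hζ
        have hua : u = ⟨a, haN⟩ := Subtype.ext hu
        rw [hua, hζ.2]
        show Function.updateFinset z (copyOf C x N'.toFinset) _ (move C x a) = z x
        rw [hxa]
        simp only [Function.updateFinset, hnotx, dite_false]
      · have h1 := hmoveN' ⟨u, hu⟩
        simp only [Function.updateFinset, h1, dite_true, last_move (hr u u.2)]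
        simp
    · intro y _
      rw [mul_left_comm, mul_comm]
      congr 1
      rw [Finset.prod_mul_distrib]
      have hbij : Function.Bijective (fun u : {k : N // k.1 ≠ a} =>
          (⟨move C x u.1.1, hmoveN' u⟩ : ↥(copyOf C x N'.toFinset))) := by
        constructor
        · intro u v h
          exact Subtype.ext (Subtype.ext (move_inj (hr _ u.1.2) (hr _ v.1.2)
            (congrArg Subtype.val h)))
        · intro k
          obtain ⟨u, hu, hk⟩ := Finset.mem_image.1 k.2
          rw [Set.mem_toFinset] at hu
          exact ⟨⟨⟨u, hu.1⟩, hu.2⟩, Subtype.ext hk⟩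
      congr 1
      · refine (Fintype.prod_bijective _ hbij _ _ fun u => ?_).symm
        rw [hw _ (by rw [hbranch]; exact Finset.mem_union_left _ (hmoveN' u))]
        simp only [Function.updateFinset, hmoveN' u, dite_true]
      · refine (Finset.prod_bij (fun (u : {k : N // k.1 ≠ a}) _ => u.1.1) ?_ ?_ ?_ ?_).symm
        · intro u _
          exact Set.mem_toFinset.2 ⟨u.1.2, u.2⟩
        · intro u _ v _ h
          exact Subtype.ext (Subtype.ext h)
        · intro u hu
          rw [Set.mem_toFinset] at hu
          exact ⟨⟨⟨u, hu.1⟩, hu.2⟩, Finset.mem_univ _, rfl⟩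
        · intro u _
          rfl

open Classical in
/-- The set of vertices over which `edgeSum` sums: the copies of the vertices at distance at most
`m` from `a` or `b` in the copy of `C` through `x`, with the branches that leave this copy. -/
noncomputable def edgeNbhd (C : Fin c) (x : Vertex A v₁) (a b : Fin n) (m : ℕ) :
    Finset (Vertex A v₁) :=
  copyOf C x ((A C).nbhd {a, b} m).toFinset ∪ hanging C x ((A C).nbhd {a, b} m).toFinset
    fun k => m - min ((A C).dist k a) ((A C).dist k b)

theorem _root_.SimpleGraph.reachable_of_mem_nbhd_pair {H : SimpleGraph (Fin n)} {a b u : Fin n}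
    {m : ℕ}
    (hab : H.Adj a b) (h : u ∈ H.nbhd {a, b} m) : H.Reachable a u := by
  obtain ⟨t, ht, h⟩ := h
  have h1 : H.Reachable t u :=
    SimpleGraph.reachable_of_edist_ne_top (ne_top_of_le_ne_top (ENat.natCast_ne_top m) h)
  rcases ht with rfl | ht
  · exact h1
  · rw [Set.mem_singleton_iff] at ht
    exact hab.reachable.trans (ht ▸ h1)

/-- The sum over all spins of the neighbourhood of an edge is the edge sum of the atom. -/
theorem marginal_edgeNbhd (Θ : Angles p) (σ : QubitOp) {C : Fin c} {x y : Vertex A v₁}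
    (hxy : IsEdgeOfType C x y) (z : Vertex A v₁ → Config p) :
    marginal (fun v => vertexWeight μ Θ (if v = x ∨ v = y then σ else 1))
        (edgeNbhd C x x.last y.last p)
        (edgeProd (edgeFactor Θ) (graph A v₁) (edgeNbhd C x x.last y.last p)) z =
      edgeSum μ Θ A C x.last y.last σ := by
  classical
  rw [isEdgeOfType_iff] at hxy
  -- The copy of `C` is reached from `x`, and `y` is its vertex over `b`.
  set a := x.last with ha
  set b := y.last with hb
  set N : Set (Fin n) := (A C).nbhd {a, b} p with hN
  set D : Fin n → ℕ := fun k => p - min ((A C).dist k a) ((A C).dist k b) with hD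
  set w : Vertex A v₁ → Config p → ℂ :=
    fun v => vertexWeight μ Θ (if v = x ∨ v = y then σ else 1) with hw
  have hr : ∀ u ∈ N, (A C).Reachable a u := fun u hu =>
    SimpleGraph.reachable_of_mem_nbhd_pair hxy.2 hu
  have hx : ∀ u ∈ N, move C x u = x ↔ u = a := by
    intro u hu
    constructor
    · intro h
      rw [← last_move (hr u hu), h]
    · rintro rfl
      exact move_self C x
  have hy : ∀ u ∈ N, move C x u = y ↔ u = b := by
    intro u hu
    constructor
    · intro h
      rw [← last_move (hr u hu), h]
    · rintro rfl
      exact move_last hxy.1.symm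
  have hprod : ∀ z : Vertex A v₁ → Config p, ∏ u ∈ N.toFinset, ∏ C' ∈ Finset.univ.erase C,
      marginal w (branch C' (move C x u) (D u)) (edgeProd (edgeFactor Θ) (graph A v₁)
        (insert (move C x u) (branch C' (move C x u) (D u)))) z =
      ∏ u ∈ N.toFinset, ∏ C' ∈ Finset.univ.erase C, branchSum μ Θ A (D u) C' u
        (z (move C x u)) := by
    intro z
    refine Finset.prod_congr rfl fun u hu => Finset.prod_congr rfl fun C' hC' => ?_
    have hu' := Set.mem_toFinset.1 hu
    rw [marginal_branch μ Θ w, last_move (hr u hu')]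
    intro v hv
    have hv' := branch_subset_beyond hv
    have hne : C' ≠ C := (Finset.mem_erase.1 hC').1
    rw [hw]
    beta_reduce
    rw [if_neg]
    rintro (rfl | rfl)
    · exact notMem_beyond_of_stem_eq (stem_move _ _ _).symm hne hv'
    · exact notMem_beyond_of_stem_eq (hxy.1.symm.trans (stem_move _ _ _).symm) hne hv'
  have hmove : ∀ u : N, move C x u.1 ∈ copyOf C x N.toFinset := fun u =>
    Finset.mem_image_of_mem _ (Set.mem_toFinset.2 u.2)
  have hU : edgeNbhd C x a b p = copyOf C x N.toFinset ∪ hanging C x N.toFinset D := by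
    rw [edgeNbhd]
  rw [hU, marginal_union w disjoint_copyOf_hanging,
    marginal_hanging w _ (by simpa using hr) subset_rfl, edgeSum, marginal]
  simp only [hprod, edgeProd_copyOf Θ hr]
  refine Finset.sum_bij'
    (fun y _ => fun u : N => Function.updateFinset z (copyOf C x N.toFinset) y (move C x u.1))
    (fun ζ _ => fun k => if h : k.1.last ∈ N then ζ ⟨k.1.last, h⟩ else z x) ?_ ?_ ?_ ?_ ?_
  · intro y _
    exact Finset.mem_univ _
  · intro ζ _
    exact Finset.mem_univ _
  · intro y _
    funext k
    obtain ⟨u, hu, hk⟩ := Finset.mem_image.1 k.2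
    have hu' := Set.mem_toFinset.1 hu
    have hlast : k.1.last = u := by rw [← hk, last_move (hr u hu')]
    have hkN : k.1.last ∈ N := hlast ▸ hu'
    rw [dif_pos hkN]
    simp only [hlast, hk, Function.updateFinset, k.2, dite_true]
  · intro ζ hζ
    funext u
    simp only [Function.updateFinset, hmove u, dite_true, last_move (hr u u.2)]
    simp
  · intro y _
    rw [mul_left_comm, mul_comm]
    congr 1
    rw [Finset.prod_mul_distrib]
    have hbij : Function.Bijective (fun u : N =>
        (⟨move C x u.1, hmove u⟩ : ↥(copyOf C x N.toFinset))) := by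
      constructor
      · intro u v h
        exact Subtype.ext (move_inj (hr _ u.2) (hr _ v.2) (congrArg Subtype.val h))
      · intro k
        obtain ⟨u, hu, hk⟩ := Finset.mem_image.1 k.2
        rw [Set.mem_toFinset] at hu
        exact ⟨⟨u, hu⟩, Subtype.ext hk⟩
    congr 1
    · refine (Fintype.prod_bijective _ hbij _ _ fun u => ?_).symm
      rw [hw]
      beta_reduce
      simp only [hx u u.2, hy u u.2, Function.updateFinset, hmove u, dite_true]
    · refine (Finset.prod_bij (fun (u : N) _ => u.1) ?_ ?_ ?_ ?_).symm
      · intro u _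
        exact Set.mem_toFinset.2 u.2
      · intro u _ v _ h
        exact Subtype.ext h
      · intro u hu
        rw [Set.mem_toFinset] at hu
        exact ⟨⟨u, hu⟩, Finset.mem_univ _, rfl⟩
      · intro u _
        rfl

theorem _root_.SimpleGraph.min_dist_le_of_mem_nbhd {H : SimpleGraph (Fin n)} {a b u : Fin n} {m : ℕ}
    (h : u ∈ H.nbhd {a, b} m) : min (H.dist u a) (H.dist u b) ≤ m := by
  obtain ⟨t, ht, h⟩ := h
  have hr : H.Reachable t u :=
    SimpleGraph.reachable_of_edist_ne_top (ne_top_of_le_ne_top (ENat.natCast_ne_top m) h)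
  rw [← hr.coe_dist_eq_edist, Nat.cast_le, SimpleGraph.dist_comm] at h
  rcases ht with rfl | rfl
  · exact (min_le_left _ _).trans h
  · exact (min_le_right _ _).trans h

theorem _root_.SimpleGraph.mem_or_exists_adj_of_mem_nbhd_succ {W : Type*} {H : SimpleGraph W}
    {T : Set W} {m : ℕ} {v : W}
    (h : v ∈ H.nbhd T (m + 1)) : v ∈ T ∨ ∃ u ∈ H.nbhd T m, H.Adj u v := by
  obtain ⟨t, ht, h⟩ := h
  have hr : H.Reachable t v :=
    SimpleGraph.reachable_of_edist_ne_top (ne_top_of_le_ne_top (ENat.natCast_ne_top (m + 1)) h)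
  obtain ⟨q, hq⟩ := hr.symm.exists_walk_length_eq_edist
  cases q with
  | nil => exact Or.inl ht
  | @cons _ u _ hadj q =>
    refine Or.inr ⟨u, ⟨t, ht, ?_⟩, hadj.symm⟩
    rw [SimpleGraph.edist_comm] at h
    rw [← hq] at h
    rw [SimpleGraph.edist_comm]
    refine q.edist_le.trans ?_
    rw [SimpleGraph.Walk.length_cons] at h
    have h' : q.length + 1 ≤ m + 1 := by exact_mod_cast h
    exact_mod_cast Nat.le_of_succ_le_succ h'

/-- The neighbourhood of an edge contains the ball around it. -/
theorem nbhd_subset_edgeNbhd {C : Fin c} {x y : Vertex A v₁} (hxy : IsEdgeOfType C x y) (m : ℕ) :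
    (graph A v₁).nbhd {x, y} m ⊆ edgeNbhd C x x.last y.last m := by
  classical
  rw [isEdgeOfType_iff] at hxy
  have hr : ∀ {u m}, u ∈ (A C).nbhd {x.last, y.last} m → (A C).Reachable x.last u :=
    fun hu => SimpleGraph.reachable_of_mem_nbhd_pair hxy.2 hu
  have hmem : ∀ {v m}, v ∈ edgeNbhd C x x.last y.last m ↔
      (∃ u ∈ (A C).nbhd {x.last, y.last} m, v = move C x u) ∨
      ∃ u ∈ (A C).nbhd {x.last, y.last} m, ∃ C', C' ≠ C ∧ v ∈ branch C' (move C x u)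
        (m - min ((A C).dist u x.last) ((A C).dist u y.last)) := by
    intro v m
    simp only [edgeNbhd, Finset.mem_union, copyOf, Finset.mem_image, mem_hanging,
      Set.mem_toFinset, eq_comm]
  have hbase : ∀ m, ∀ v ∈ ({x, y} : Set (Vertex A v₁)), v ∈ edgeNbhd C x x.last y.last m := by
    intro m v hv
    refine hmem.2 (Or.inl ⟨v.last, (A C).mem_nbhd_of_mem m ?_, ?_⟩)
    · rcases hv with rfl | rfl <;> simp
    · rcases hv with rfl | rfl
      · exact (move_self _ _).symm
      · exact (move_last hxy.1.symm).symm
  induction m with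
  | zero =>
    rintro v ⟨t, ht, h⟩
    have : (graph A v₁).edist t v = 0 := by simpa using h
    rw [← SimpleGraph.edist_eq_zero_iff.1 this]
    exact hbase 0 t ht
  | succ m ih =>
    intro v' hv'
    rcases SimpleGraph.mem_or_exists_adj_of_mem_nbhd_succ hv' with hv' | ⟨v, hv, E, hE⟩
    · exact hbase _ _ hv'
    have hv := hmem.1 (ih hv)
    -- The vertex `k` of the copy of `C` at which the part containing `v` hangs.
    obtain ⟨u, hu, hk⟩ : ∃ u ∈ (A C).nbhd {x.last, y.last} m, v = move C x u ∨
        ∃ C', C' ≠ C ∧ v ∈ branch C' (move C x u)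
          (m - min ((A C).dist u x.last) ((A C).dist u y.last)) := by
      rcases hv with ⟨u, hu, h⟩ | ⟨u, hu, h⟩
      · exact ⟨u, hu, Or.inl h⟩
      · exact ⟨u, hu, Or.inr h⟩
    have hu' := SimpleGraph.nbhd_mono (Nat.le_succ m) hu
    set k := move C x u with hkdef
    have hstem : stem C k = stem C x := stem_move _ _ _
    have hvk : v ∉ beyond C k := by
      rcases hk with rfl | ⟨C', hC', h⟩
      · exact self_notMem_beyond _ _
      · exact beyond_disjoint hC' (branch_subset_beyond h)
    by_cases hk' : v' ∈ beyond C k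
    · obtain ⟨h1, rfl⟩ := eq_of_adj_beyond hE hvk hk'
      rw [isEdgeOfType_iff] at hE
      have hlast : v.last = u := h1 ▸ last_move (hr hu)
      refine hmem.2 (Or.inl ⟨v'.last, SimpleGraph.nbhd_succ_of_adj (hlast ▸ hu) hE.2, ?_⟩)
      exact (move_last (hE.1.symm.trans (h1 ▸ hstem))).symm
    · by_cases hvk' : v' = k
      · exact hmem.2 (Or.inl ⟨u, hu', hvk'⟩)
      obtain ⟨C', hC'⟩ := exists_mem_beyond hvk'
      have hne' : C' ≠ C := by rintro rfl; exact hk' hC'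
      refine hmem.2 (Or.inr ⟨u, hu', C', hne', ?_⟩)
      rw [Nat.sub_add_comm (SimpleGraph.min_dist_le_of_mem_nbhd hu)]
      refine branch_step ?_ hE hC'
      rcases hk with h | ⟨C'', hC'', h⟩
      · exact Or.inl h
      · right
        have : C'' = C' := by
          by_contra hcc
          exact hvk' (eq_of_adj_beyond (IsEdgeOfType.symm hE)
            (beyond_disjoint (Ne.symm hcc) hC') (branch_subset_beyond h)).1
        exact this ▸ h

end HamQAOA

/-! ### Single-qubit path sums -/

namespace HamQAOA

open Matrix

variable {p : ℕ}

/-- The weight of a pair of computational-basis paths `x`, `y` through one circuit and its inverse,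
which meet at their last points. -/
noncomputable def pathWeight (bra ket : Fin p → QubitOp) (l r : ℤˣ → ℂ) (x y : Fin (p + 1) → ℤˣ) :
    ℂ :=
  l (x 0) * (∏ j : Fin p, bra j (x j.castSucc) (x j.succ)) *
    (1 : QubitOp) (x (Fin.last p)) (y (Fin.last p)) *
    (∏ j : Fin p, ket j (y j.succ) (y j.castSucc)) * r (y 0)

theorem sum_snoc {α M : Type*} [Fintype α] [AddCommMonoid M] (F : (Fin (p + 2) → α) → M) :
    ∑ x, F x = ∑ x : Fin (p + 1) → α, ∑ s, F (Fin.snoc (α := fun _ => α) x s) := by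
  rw [← (Fin.snocEquiv fun _ : Fin (p + 2) => α).sum_comp, Fintype.sum_prod_type,
    Finset.sum_comm]
  rfl

/-- The last layer cancels against its inverse in an observable of the earlier layers. -/
theorem sum_pathWeight_succ {bra ket : Fin (p + 1) → QubitOp}
    (h : bra (Fin.last p) * ket (Fin.last p) = 1) (l r : ℤˣ → ℂ) (g : (Fin (p + 1) → ℤˣ) → (Fin
    (p + 1) → ℤˣ) → ℂ) :
    ∑ x, ∑ y, pathWeight bra ket l r x y * g (Fin.init x) (Fin.init y) =
      ∑ x, ∑ y, pathWeight (fun j => bra j.castSucc) (fun j => ket j.castSucc) l r x y *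
        g x y := by
  simp only [sum_snoc, Fin.init_snoc]
  refine Finset.sum_congr rfl fun x _ => ?_
  rw [Finset.sum_comm]
  refine Finset.sum_congr rfl fun y _ => ?_
  have key := congrFun (congrFun h (x (Fin.last p))) (y (Fin.last p))
  rw [Matrix.mul_apply] at key
  have hsum : ∀ s t : ℤˣ, pathWeight bra ket l r (Fin.snoc (α := fun _ => ℤˣ) x s)
      (Fin.snoc (α := fun _ => ℤˣ) y t) * g x y =
      (l (x 0) * (∏ j : Fin p, bra j.castSucc (x j.castSucc) (x j.succ)) *
      (∏ j : Fin p, ket j.castSucc (y j.succ) (y j.castSucc)) * r (y 0) * g x y) *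
      (if s = t then bra (Fin.last p) (x (Fin.last p)) s *
        ket (Fin.last p) t (y (Fin.last p)) else 0) := by
    intro s t
    have h0 : ∀ (x : Fin (p + 1) → ℤˣ) (s : ℤˣ),
        (Fin.snoc (α := fun _ => ℤˣ) x s : Fin (p + 2) → ℤˣ) 0 = x 0 := fun x s =>
      Fin.snoc_castSucc (α := fun _ => ℤˣ) s x 0
    have h1 : ∀ (x : Fin (p + 1) → ℤˣ) (s : ℤˣ) (j : Fin p),
        (Fin.snoc (α := fun _ => ℤˣ) x s : Fin (p + 2) → ℤˣ) j.castSucc.succ = x j.succ :=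
      fun x s j => Fin.snoc_castSucc (α := fun _ => ℤˣ) s x j.succ
    simp only [pathWeight, Fin.prod_univ_castSucc, Fin.snoc_castSucc, h0, h1, Fin.snoc_last,
      Fin.succ_last, Matrix.one_apply]
    split_ifs <;> ring
  simp only [hsum, ← Finset.mul_sum, Finset.sum_ite_eq, Finset.mem_univ, if_true]
  rw [key, pathWeight]
  ring

theorem sum_pathWeight {bra ket : Fin p → QubitOp} (h : ∀ j, bra j * ket j = 1) (l r : ℤˣ → ℂ) :
    ∑ x, ∑ y, pathWeight bra ket l r x y = ∑ s, l s * r s := by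
  induction p with
  | zero =>
    rw [← (Equiv.funUnique (Fin 1) ℤˣ).symm.sum_comp]
    refine Finset.sum_congr rfl fun s _ => ?_
    rw [← (Equiv.funUnique (Fin 1) ℤˣ).symm.sum_comp]
    simp only [pathWeight, Matrix.one_apply, Finset.univ_eq_empty, Finset.prod_empty, mul_one]
    simp only [Fin.last_zero, Equiv.funUnique_symm_apply, uniqueElim_const, mul_ite, ite_mul,
      mul_one, mul_zero, zero_mul, Finset.sum_ite_eq, Finset.mem_univ, if_true]
  | succ p ih =>
    have := sum_pathWeight_succ (h (Fin.last p)) l r (fun _ _ => 1)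
    simp only [mul_one] at this
    rw [this]
    exact ih fun j => h _

/-- Causality: for an observable of the layers up to `q`, only pairs of paths that agree at `q`
contribute, because the later layers cancel against their inverses. -/
theorem sum_pathWeight_mul {bra ket : Fin p → QubitOp} (h : ∀ j, bra j * ket j = 1)
    (l r : ℤˣ → ℂ) (q : Fin (p + 1)) (g : (Fin (p + 1) → ℤˣ) → (Fin (p + 1) → ℤˣ) → ℂ)
    (hg : ∀ x x' y y', (∀ i ≤ q, x i = x' i) → (∀ i ≤ q, y i = y' i) → g x y = g x' y') :
    ∑ x, ∑ y, pathWeight bra ket l r x y * g x y =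
      ∑ x, ∑ y, pathWeight bra ket l r x y * (if x q = y q then g x y else 0) := by
  induction p with
  | zero =>
    refine Finset.sum_congr rfl fun x _ => Finset.sum_congr rfl fun y _ => ?_
    have hq : q = Fin.last 0 := Fin.eq_zero q
    split_ifs with hxy
    · rfl
    · rw [hq] at hxy
      simp only [pathWeight, Matrix.one_apply, hxy, if_false]
      ring
  | succ p ih =>
    induction q using Fin.lastCases with
    | last =>
      refine Finset.sum_congr rfl fun x _ => Finset.sum_congr rfl fun y _ => ?_
      split_ifs with hxy
      · rfl
      · simp only [pathWeight, Matrix.one_apply, hxy, if_false]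
        ring
    | cast q =>
      have hle : ∀ (x : Fin (p + 2) → ℤˣ) (s : ℤˣ), ∀ i ≤ q.castSucc, x i =
          (Fin.snoc (α := fun _ => ℤˣ) (Fin.init x) s : Fin (p + 2) → ℤˣ) i := by
        intro x s i hi
        induction i using Fin.lastCases with
        | last => exact absurd hi (not_le.2 (Fin.castSucc_lt_last _))
        | cast i => rw [Fin.snoc_castSucc]; rfl
      set g' : (Fin (p + 1) → ℤˣ) → (Fin (p + 1) → ℤˣ) → ℂ := fun x y =>
        g (Fin.snoc (α := fun _ => ℤˣ) x 1) (Fin.snoc (α := fun _ => ℤˣ) y 1) with hg'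
      have h1 : ∀ x y, g x y = g' (Fin.init x) (Fin.init y) := fun x y =>
        hg _ _ _ _ (hle x 1) (hle y 1)
      have h2 : ∀ x y : Fin (p + 2) → ℤˣ, (if x q.castSucc = y q.castSucc then g x y else 0) =
          (fun x y : Fin (p + 1) → ℤˣ => if x q = y q then g' x y else 0) (Fin.init x)
            (Fin.init y) := by
        intro x y
        rw [h1]
        rfl
      simp only [h2]
      simp only [h1]
      rw [sum_pathWeight_succ (h _), sum_pathWeight_succ (h _) l r
        (fun x y : Fin (p + 1) → ℤˣ => if x q = y q then g' x y else 0)]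
      refine ih (fun j => h _) q g' fun x x' y y' hx hy => hg _ _ _ _ ?_ ?_
      · intro i hi
        induction i using Fin.lastCases with
        | last => exact absurd hi (not_le.2 (Fin.castSucc_lt_last _))
        | cast i => rw [Fin.snoc_castSucc, Fin.snoc_castSucc]; exact hx i hi
      · intro i hi
        induction i using Fin.lastCases with
        | last => exact absurd hi (not_le.2 (Fin.castSucc_lt_last _))
        | cast i => rw [Fin.snoc_castSucc, Fin.snoc_castSucc]; exact hy i hi

/-! ### The single-qubit factors of the circuit -/

theorem pauliX_isHermitian : pauliX.IsHermitian := by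
  ext s t
  simp [pauliX, Matrix.conjTranspose_apply, eq_comm]

theorem pauliZ_isHermitian : pauliZ.IsHermitian := by
  ext s t
  by_cases h : s = t
  · subst h; simp [pauliZ, Matrix.conjTranspose_apply]
  · simp [pauliZ, Matrix.conjTranspose_apply, h, Ne.symm h]

theorem pauliY_isHermitian : pauliY.IsHermitian := by
  ext s t
  rcases Int.units_eq_one_or s with rfl | rfl <;> rcases Int.units_eq_one_or t with rfl | rfl <;>
    simp [pauliY, Matrix.conjTranspose_apply]

theorem pauliDot_isHermitian (u : Direction) : (pauliDot u).IsHermitian := by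
  have h : ∀ (r : ℝ) {M : QubitOp}, M.IsHermitian → ((r : ℂ) • M).IsHermitian := by
    intro r M hM
    rw [Matrix.IsHermitian, Matrix.conjTranspose_smul, hM.eq]
    simp
  exact ((h _ pauliX_isHermitian).add (h _ pauliY_isHermitian)).add (h _ pauliZ_isHermitian)

theorem conjTranspose_exp_I_smul (θ : ℝ) {M : QubitOp} (hM : M.IsHermitian) :
    (NormedSpace.exp ((-(Complex.I * (θ : ℂ))) • M))ᴴ =
      NormedSpace.exp ((Complex.I * (θ : ℂ)) • M) := by
  rw [← Matrix.exp_conjTranspose, Matrix.conjTranspose_smul, hM.eq]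
  simp

theorem exp_mul_exp_neg_smul {m : Type*} [Fintype m] [DecidableEq m] (θ : ℂ) (M : Matrix m m ℂ) :
    NormedSpace.exp (θ • M) * NormedSpace.exp ((-θ) • M) = 1 := by
  rw [neg_smul, Matrix.exp_neg]
  exact Matrix.mul_nonsing_inv _ ((Matrix.isUnit_iff_isUnit_det _).1 (Matrix.isUnit_exp _))

theorem conjTranspose_ketFactor (Θ : Angles p) (u : Direction) (j : Fin p) :
    (ketFactor Θ u j)ᴴ = braFactor Θ u j := by
  rw [ketFactor, braFactor, Matrix.conjTranspose_mul, Matrix.conjTranspose_mul,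
    conjTranspose_exp_I_smul _ (pauliDot_isHermitian u),
    conjTranspose_exp_I_smul _ pauliX_isHermitian, conjTranspose_exp_I_smul _ pauliZ_isHermitian,
    mul_assoc]

theorem braFactor_mul_ketFactor (Θ : Angles p) (u : Direction) (j : Fin p) :
    braFactor Θ u j * ketFactor Θ u j = 1 := by
  rw [ketFactor, braFactor]
  generalize hX : NormedSpace.exp ((Complex.I * (Θ.β j : ℂ)) • pauliX) = X
  generalize hX' : NormedSpace.exp ((-(Complex.I * (Θ.β j : ℂ))) • pauliX) = X'
  generalize hY : NormedSpace.exp ((Complex.I * (Θ.γ j : ℂ)) • pauliZ) = Y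
  generalize hY' : NormedSpace.exp ((-(Complex.I * (Θ.γ j : ℂ))) • pauliZ) = Y'
  generalize hZ : NormedSpace.exp ((Complex.I * (Θ.δ j : ℂ)) • pauliDot u) = Z
  generalize hZ' : NormedSpace.exp ((-(Complex.I * (Θ.δ j : ℂ))) • pauliDot u) = Z'
  have h1 : X * X' = 1 := by rw [← hX, ← hX']; exact exp_mul_exp_neg_smul _ _
  have h2 : Y * Y' = 1 := by rw [← hY, ← hY']; exact exp_mul_exp_neg_smul _ _
  have h3 : Z * Z' = 1 := by rw [← hZ, ← hZ']; exact exp_mul_exp_neg_smul _ _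
  calc X * Y * Z * (Z' * Y' * X') = X * (Y * (Z * Z') * Y') * X' := by simp only [mul_assoc]
    _ = 1 := by rw [h3, mul_one, h2, mul_one, h1]

theorem direction_sq (u : Direction) : u.1 0 ^ 2 + u.1 1 ^ 2 + u.1 2 ^ 2 = 1 := by
  have h := u.2
  rw [mem_sphere_zero_iff_norm] at h
  have h2 := EuclideanSpace.norm_sq_eq u.1
  rw [h, Fin.sum_univ_three] at h2
  simpa using h2.symm

theorem sum_star_blochKet (u : Direction) : ∑ s, star (blochKet u s) * blochKet u s = 1 := by
  have hu := direction_sq u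
  have hsum : ∀ f : ℤˣ → ℂ, ∑ s, f s = f 1 + f (-1) := by
    intro f
    rw [show (Finset.univ : Finset ℤˣ) = {1, -1} from rfl, Finset.sum_pair (by decide)]
  have hne : (-1 : ℤˣ) ≠ 1 := by decide
  rw [hsum]
  by_cases h : u.1 2 = -1
  · simp [blochKet, h, hne]
  have hpos : 0 < 1 + u.1 2 := by
    have h1 : -1 ≤ u.1 2 := by nlinarith [sq_nonneg (u.1 0), sq_nonneg (u.1 1)]
    rcases h1.lt_or_eq with h1 | h1
    · linarith
    · exact absurd h1.symm h
  simp only [blochKet, h, hne, if_false, if_true, Complex.star_def, Complex.conj_mul']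
  rw [← Complex.ofReal_pow, ← Complex.ofReal_pow, ← Complex.ofReal_add]
  rw [show (1 : ℂ) = ((1 : ℝ) : ℂ) by simp]
  congr 1
  rw [norm_div, Complex.norm_real, Complex.norm_real, div_pow, Real.norm_eq_abs, Real.norm_eq_abs,
    sq_abs, sq_abs, Real.sq_sqrt (by positivity), Real.sq_sqrt (by positivity),
    Complex.sq_norm, Complex.normSq_apply]
  simp
  field_simp
  nlinarith

end HamQAOA

/-! ### The vertex weights -/

namespace HamQAOA

open Matrix MeasureTheory

variable {p : ℕ}

/-- The quantity averaged in `vertexWeight`, for fixed directions `mn = (m, n)`. -/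
noncomputable def siteAmp (Θ : Angles p) (σ : QubitOp) (z : Config p) (mn : Direction × Direction) :
    ℂ :=
  star (blochKet mn.1 (z (.inl 0))) *
    (∏ j : Fin p, braFactor Θ mn.2 j (z (.inl j.castSucc)) (z (.inl j.succ))) *
    σ (z (.inl (Fin.last p))) (z (.inr (Fin.last p))) *
    (∏ j : Fin p, ketFactor Θ mn.2 j (z (.inr j.succ)) (z (.inr j.castSucc))) *
    blochKet mn.1 (z (.inr 0))

/-- Measurable functions with bounded values: an algebra of integrable functions. -/
structure IsBddMeas {Ω : Type*} [MeasurableSpace Ω] (f : Ω → ℂ) : Prop where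
  measurable : Measurable f
  bounded : ∃ M : ℝ, ∀ x, ‖f x‖ ≤ M

namespace IsBddMeas

variable {Ω : Type*} [MeasurableSpace Ω]

theorem const (a : ℂ) : IsBddMeas fun _ : Ω => a := ⟨measurable_const, ‖a‖, fun _ => le_rfl⟩

theorem mul {f g : Ω → ℂ} (hf : IsBddMeas f) (hg : IsBddMeas g) : IsBddMeas fun x => f x * g x := by
  obtain ⟨M, hM⟩ := hf.bounded
  obtain ⟨N, hN⟩ := hg.bounded
  refine ⟨hf.measurable.mul hg.measurable, M * N, fun x => ?_⟩
  rw [norm_mul]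
  exact mul_le_mul (hM x) (hN x) (norm_nonneg _) ((norm_nonneg _).trans (hM x))

theorem star {f : Ω → ℂ} (hf : IsBddMeas f) : IsBddMeas fun x => star (f x) := by
  obtain ⟨M, hM⟩ := hf.bounded
  exact ⟨continuous_star.measurable.comp hf.measurable, M, fun x => by rw [norm_star]; exact hM x⟩

theorem prod {ι : Type*} {s : Finset ι} {f : ι → Ω → ℂ} (hf : ∀ i, IsBddMeas (f i)) :
    IsBddMeas fun x => ∏ i ∈ s, f i x := by
  classical
  induction s using Finset.induction_on with
  | empty => simpa using const 1
  | insert i s hi ih =>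
    simp only [Finset.prod_insert hi]
    exact (hf i).mul ih

theorem integrable {f : Ω → ℂ} (hf : IsBddMeas f) (ν : Measure Ω) [IsFiniteMeasure ν] :
    Integrable f ν := by
  obtain ⟨M, hM⟩ := hf.bounded
  exact Integrable.of_bound hf.measurable.aestronglyMeasurable M (Filter.Eventually.of_forall hM)

theorem comp {Ω' : Type*} [MeasurableSpace Ω'] {f : Ω → ℂ} (hf : IsBddMeas f) {g : Ω' → Ω}
    (hg : Measurable g) : IsBddMeas fun x => f (g x) :=
  ⟨hf.measurable.comp hg, hf.bounded.imp fun _ h _ => h _⟩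

theorem of_continuous [TopologicalSpace Ω] [CompactSpace Ω] [OpensMeasurableSpace Ω] {f : Ω → ℂ}
    (hf : Continuous f) : IsBddMeas f := by
  obtain ⟨M, hM⟩ := isCompact_univ.exists_bound_of_continuousOn hf.continuousOn
  exact ⟨hf.measurable, M, fun x => hM x (Set.mem_univ x)⟩

end IsBddMeas

theorem isBddMeas_blochKet (s : ℤˣ) : IsBddMeas fun u : Direction => blochKet u s := by
  constructor
  · have h2 : ∀ i : Fin 3, Measurable fun u : Direction => u.1 i := fun i => by
      have : Continuous fun u : Direction => u.1 i := by fun_prop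
      exact this.measurable
    unfold blochKet
    refine Measurable.ite (measurableSet_eq_fun (h2 2) measurable_const) measurable_const ?_
    by_cases hs : s = 1
    · simp only [hs, if_true]
      have := h2 2
      fun_prop
    · simp only [hs, if_false]
      have h0 := h2 0
      have h1 := h2 1
      have h2 := h2 2
      fun_prop
  · refine ⟨1, fun u => ?_⟩
    have h := sum_star_blochKet u
    simp only [Complex.star_def, Complex.conj_mul'] at h
    have h' : ∑ s, ‖blochKet u s‖ ^ 2 = 1 := by exact_mod_cast h
    have h3 : ‖blochKet u s‖ ^ 2 ≤ 1 := by
      rw [← h']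
      exact Finset.single_le_sum (f := fun s => ‖blochKet u s‖ ^ 2) (fun i _ => by positivity)
        (Finset.mem_univ s)
    nlinarith [norm_nonneg (blochKet u s)]

theorem continuous_matrix_exp {m : Type*} [Fintype m] [DecidableEq m] :
    Continuous (NormedSpace.exp : Matrix m m ℂ → Matrix m m ℂ) := by
  let _ : NormedRing (Matrix m m ℂ) := Matrix.linftyOpNormedRing
  let _ : NormedAlgebra ℂ (Matrix m m ℂ) := Matrix.linftyOpNormedAlgebra
  let _ : NormedAlgebra ℚ (Matrix m m ℂ) := NormedAlgebra.restrictScalars ℚ ℂ _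
  exact NormedSpace.exp_continuous

theorem continuous_pauliDot : Continuous pauliDot := by
  unfold pauliDot
  fun_prop

theorem isBddMeas_ketFactor (Θ : Angles p) (j : Fin p) (s t : ℤˣ) :
    IsBddMeas fun u : Direction => ketFactor Θ u j s t := by
  refine IsBddMeas.of_continuous ?_
  have h : Continuous fun u : Direction => ketFactor Θ u j := by
    unfold ketFactor
    have h1 : Continuous fun u : Direction =>
        NormedSpace.exp ((-(Complex.I * (Θ.δ j : ℂ))) • pauliDot u) :=
      continuous_matrix_exp.comp
        (continuous_pauliDot.const_smul (-(Complex.I * (Θ.δ j : ℂ))))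
    exact (h1.matrix_mul continuous_const).matrix_mul continuous_const
  exact h.matrix_elem s t

theorem isBddMeas_braFactor (Θ : Angles p) (j : Fin p) (s t : ℤˣ) :
    IsBddMeas fun u : Direction => braFactor Θ u j s t := by
  simp only [← conjTranspose_ketFactor, Matrix.conjTranspose_apply]
  exact (isBddMeas_ketFactor Θ j t s).star

theorem isBddMeas_siteAmp (Θ : Angles p) (σ : QubitOp) (z : Config p) :
    IsBddMeas (siteAmp Θ σ z) := by
  unfold siteAmp
  exact (((((isBddMeas_blochKet _).comp measurable_fst).star.mul
    (IsBddMeas.prod fun j => (isBddMeas_braFactor Θ j _ _).comp measurable_snd)).mul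
    (IsBddMeas.const _)).mul
    (IsBddMeas.prod fun j => (isBddMeas_ketFactor Θ j _ _).comp measurable_snd)).mul
    ((isBddMeas_blochKet _).comp measurable_fst)

theorem siteAmp_one (Θ : Angles p) (x y : Fin (p + 1) → ℤˣ) (mn : Direction × Direction) :
    siteAmp Θ 1 (Sum.elim x y) mn = pathWeight (braFactor Θ mn.2) (ketFactor Θ mn.2)
      (fun s => star (blochKet mn.1 s)) (blochKet mn.1) x y := rfl

theorem sum_config {M : Type*} [AddCommMonoid M] (F : Config p → M) :
    ∑ z, F z = ∑ x, ∑ y, F (Sum.elim x y) := by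
  rw [← (Equiv.sumArrowEquivProdArrow (Fin (p + 1)) (Fin (p + 1)) ℤˣ).symm.sum_comp,
    Fintype.sum_prod_type]
  rfl

variable (μ : Measure (Direction × Direction)) [IsProbabilityMeasure μ]

theorem sum_vertexWeight_mul_eq_integral (Θ : Angles p) (σ : QubitOp) (g : Config p → ℂ) :
    ∑ z, vertexWeight μ Θ σ z * g z = ∫ mn, ∑ z, siteAmp Θ σ z mn * g z ∂μ := by
  rw [integral_finsetSum _ fun z _ => ((isBddMeas_siteAmp Θ σ z).integrable μ).mul_const _]
  exact Finset.sum_congr rfl fun z _ => (integral_mul_const _ _).symm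

/-- The weight `f^I` has total mass one. -/
theorem sum_vertexWeight_one (Θ : Angles p) : ∑ z, vertexWeight μ Θ 1 z = 1 := by
  have h := sum_vertexWeight_mul_eq_integral μ Θ 1 fun _ => 1
  simp only [mul_one] at h
  rw [h]
  have : ∀ mn, ∑ z, siteAmp Θ 1 z mn = 1 := by
    intro mn
    rw [sum_config]
    simp only [siteAmp_one]
    rw [sum_pathWeight (braFactor_mul_ketFactor Θ mn.2)]
    exact sum_star_blochKet mn.1
  simp [this]

/-- Causality for the weight `f^I`: an observable that depends only on the layers up to `q` may be
restricted to configurations whose two halves agree at `q`. -/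
theorem sum_vertexWeight_one_mul (Θ : Angles p) (q : Fin (p + 1)) (g : Config p → ℂ)
    (hg : ∀ z z' : Config p, (∀ i ≤ q, z (.inl i) = z' (.inl i) ∧ z (.inr i) = z' (.inr i)) →
      g z = g z') :
    ∑ z, vertexWeight μ Θ 1 z * g z =
      ∑ z, vertexWeight μ Θ 1 z * (if z (.inl q) = z (.inr q) then g z else 0) := by
  rw [sum_vertexWeight_mul_eq_integral,
    sum_vertexWeight_mul_eq_integral μ Θ 1 fun z => if z (.inl q) = z (.inr q) then g z else 0]
  congr 1
  funext mn
  rw [sum_config, sum_config]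
  simp only [siteAmp_one, Sum.elim_inl, Sum.elim_inr]
  exact sum_pathWeight_mul (braFactor_mul_ketFactor Θ mn.2) _ _ q (fun x y => g (Sum.elim x y))
    fun x x' y y' hx hy => hg _ _ fun i hi => ⟨hx i hi, hy i hi⟩

end HamQAOA

/-! ### The light cone -/

section Marginal

variable {V Q R : Type*} [DecidableEq V] [Fintype Q] [CommRing R]

theorem marginal_singleton (w : V → Q → R) (v : V) (F : (V → Q) → R) (z : V → Q) :
    marginal w {v} F z = ∑ ζ, w v ζ * F (Function.update z v ζ) := by
  rw [marginal, ← (Equiv.funUnique ({v} : Finset V) Q).symm.sum_comp]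
  refine Finset.sum_congr rfl fun ζ _ => ?_
  rw [Function.updateFinset_singleton]
  simp

/-- Spins of total weight one on which `F` does not depend can be dropped. -/
theorem marginal_of_dependsOn {w : V → Q → R} {T : Finset V} (hw : ∀ k ∈ T, ∑ ζ, w k ζ = 1)
    {F : (V → Q) → R} {s : Set V} (hF : DependsOn F s) (hs : Disjoint s T) :
    marginal w T F = F := by
  have h := marginal_mul_left w hF hs fun _ => 1
  simp only [mul_one] at h
  rw [h]
  funext z
  have h1 : marginal w T (fun _ => 1) z = 1 := by
    simp only [marginal, mul_one]
    rw [← Fintype.piFinset_univ, ← Finset.prod_univ_sum (fun _ : T => Finset.univ) fun k ζ => w k ζ]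
    exact Finset.prod_eq_one fun k _ => hw k k.2
  rw [h1, mul_one]

end Marginal

namespace HamQAOA

open MeasureTheory AdditiveProduct

variable {p : ℕ} {V : Type*}

/-- The phase of an edge that comes from the layer `j` of the circuit and its inverse. -/
noncomputable def layerFactor (Θ : Angles p) (j : Fin p) (e : Sym2 (Config p)) : ℂ :=
  Complex.exp (Complex.I * ((Θ.α j * (((((e.map fun ζ => ζ (.inl j.castSucc)).mul : ℤˣ) : ℤ) : ℝ) -
    ((((e.map fun ζ => ζ (.inr j.castSucc)).mul : ℤˣ) : ℤ) : ℝ)) : ℝ) : ℂ))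

theorem edgeFactor_eq_prod (Θ : Angles p) (e : Sym2 (Config p)) :
    edgeFactor Θ e = ∏ j, layerFactor Θ j e := by
  simp only [edgeFactor, layerFactor]
  rw [← Complex.exp_sum, ← Finset.mul_sum, ← Complex.ofReal_sum]
  congr 3
  rw [Fintype.sum_sum_type, Fin.sum_univ_castSucc, Fin.sum_univ_castSucc]
  simp only [paramVec, Sum.elim_inl, Sum.elim_inr, Fin.snoc_castSucc, Fin.snoc_last]
  rw [zero_mul, neg_zero, zero_mul, add_zero, add_zero, ← Finset.sum_add_distrib]
  exact Finset.sum_congr rfl fun j _ => by ring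

open Classical in
/-- The product of the phases of all edges in `S`, where for the layers from `q` on only the edges
that meet the light cone of `T` are kept: in layer `j` (counted from zero) these are the edges
with an end at distance at most `p - 1 - j` from `T`. -/
noncomputable def coneProd (Θ : Angles p) (H : SimpleGraph V) (T : Set V) (q : ℕ) (S : Finset V)
    (z : V → Config p) : ℂ :=
  ∏ e ∈ H.edgesIn S, ∏ j : Fin p,
    if q ≤ j.val ∧ ∀ x ∈ e, x ∉ H.nbhd T (p - 1 - j.val) then 1 else layerFactor Θ j (e.map z)

theorem coneProd_top (Θ : Angles p) (H : SimpleGraph V) (T : Set V) (S : Finset V) :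
    coneProd Θ H T p S = edgeProd (edgeFactor Θ) H S := by
  funext z
  rw [coneProd, edgeProd]
  refine Finset.prod_congr rfl fun e _ => ?_
  rw [edgeFactor_eq_prod]
  refine Finset.prod_congr rfl fun j _ => if_neg ?_
  rintro ⟨h, -⟩
  exact absurd j.2 (not_lt.2 h)

theorem _root_.SimpleGraph.mem_nbhd_succ_of_mem_edge {H : SimpleGraph V} {T : Set V} {e : Sym2 V}
    (he : e ∈ H.edgeSet) {x v : V} (hx : x ∈ e) (hv : v ∈ e) {m : ℕ} (h : x ∈ H.nbhd T m) :
    v ∈ H.nbhd T (m + 1) := by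
  obtain ⟨y, rfl⟩ := Sym2.mem_iff_exists.1 hx
  rcases Sym2.mem_iff.1 hv with rfl | rfl
  · exact SimpleGraph.nbhd_mono (Nat.le_succ m) h
  · exact SimpleGraph.nbhd_succ_of_adj h he

/-- Outside the light cone at layer `q`, the kept phases do not depend on the layers of `v` beyond
`q`. -/
theorem coneProd_update [DecidableEq V] (Θ : Angles p) (H : SimpleGraph V) (T : Set V) {q q' : ℕ}
    (hq : q' ≤ q + 1)
    (S : Finset V) {v : V} (hv : v ∉ H.nbhd T (p - 1 - q)) (z : V → Config p) {ζ ζ' : Config p}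
    (hζ : ∀ i : Fin (p + 1), i.val ≤ q → ζ (.inl i) = ζ' (.inl i) ∧ ζ (.inr i) = ζ' (.inr i)) :
    coneProd Θ H T q' S (Function.update z v ζ) = coneProd Θ H T q' S (Function.update z v ζ') := by
  refine Finset.prod_congr rfl fun e he => Finset.prod_congr rfl fun j _ => ?_
  split_ifs with hc
  · rfl
  by_cases hve : v ∈ e
  · -- A layer beyond `q` in which the edge is kept would put `v` inside the light cone.
    have hj : j.val ≤ q := by
      by_contra hj
      rw [not_le] at hj
      push Not at hc
      obtain ⟨x, hx, hxT⟩ := hc (hq.trans hj)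
      have := SimpleGraph.mem_nbhd_succ_of_mem_edge (SimpleGraph.mem_edgesIn.1 he).2 hx hve hxT
      exact hv (SimpleGraph.nbhd_mono (by have := j.2; omega) this)
    have h1 : ∀ x, Function.update z v ζ x (.inl j.castSucc) =
        Function.update z v ζ' x (.inl j.castSucc) ∧ Function.update z v ζ x (.inr j.castSucc) =
        Function.update z v ζ' x (.inr j.castSucc) := by
      intro x
      by_cases hx : x = v
      · subst hx
        simpa using hζ j.castSucc hj
      · simp [Function.update_of_ne hx]
    simp only [layerFactor, Sym2.map_map, Function.comp_def, h1]
  · congr 1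
    refine Sym2.map_congr fun x hx => ?_
    have : x ≠ v := by rintro rfl; exact hve hx
    rw [Function.update_of_ne this, Function.update_of_ne this]

/-- In a layer in which both halves of the configurations at the ends of an edge agree, the phases
of the circuit and of its inverse cancel. -/
theorem coneProd_succ_eq (Θ : Angles p) (H : SimpleGraph V) (T : Set V) (q : Fin p)
    (S : Finset V) (z : V → Config p)
    (hz : ∀ v ∈ S, v ∉ H.nbhd T (p - 1 - q.val) →
      z v (.inl q.castSucc) = z v (.inr q.castSucc)) :
    coneProd Θ H T (q.val + 1) S z = coneProd Θ H T q.val S z := by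
  classical
  refine Finset.prod_congr rfl fun e he => Finset.prod_congr rfl fun j _ => ?_
  by_cases hjq : j = q
  · subst hjq
    rw [if_neg (by simp)]
    split_ifs with hc
    · have : Sym2.map (fun x => z x (.inl j.castSucc)) e =
          Sym2.map (fun x => z x (.inr j.castSucc)) e :=
        Sym2.map_congr fun x hx => hz x ((SimpleGraph.mem_edgesIn.1 he).1 x hx) (hc.2 x hx)
      simp [layerFactor, Sym2.map_map, this]
    · rfl
  · have : q.val + 1 ≤ j.val ↔ q.val ≤ j.val := by
      have := fun h => hjq (Fin.ext h)
      omega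
    simp only [this]

variable (μ : Measure (Direction × Direction)) [IsProbabilityMeasure μ]

/-- `HamQAOA.sum_vertexWeight_one_mul` for all vertices in `Far` at once. -/
theorem marginal_symm [DecidableEq V] (Θ : Angles p) (w : V → Config p → ℂ) (S Far : Finset V)
    (hFar : Far ⊆ S)
    (hw : ∀ v ∈ Far, w v = vertexWeight μ Θ 1) (q : Fin (p + 1)) (F : (V → Config p) → ℂ)
    (hF : ∀ v ∈ Far, ∀ (z : V → Config p) (ζ ζ' : Config p),
      (∀ i ≤ q, ζ (.inl i) = ζ' (.inl i) ∧ ζ (.inr i) = ζ' (.inr i)) →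
        F (Function.update z v ζ) = F (Function.update z v ζ')) :
    marginal w S F =
      marginal w S fun z => if ∀ v ∈ Far, z v (.inl q) = z v (.inr q) then F z else 0 := by
  classical
  induction Far using Finset.induction_on with
  | empty => simp
  | insert v Far hv ih =>
    rw [ih (fun x hx => hFar (by simp [hx])) (fun x hx => hw x (by simp [hx]))
      (fun x hx => hF x (by simp [hx]))]
    have hvS : v ∈ S := hFar (by simp)
    have hS : S = S.erase v ∪ {v} := by
      rw [Finset.union_comm, ← Finset.insert_eq, Finset.insert_erase hvS]
    have hdisj : Disjoint (S.erase v) {v} := by simp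
    rw [hS, marginal_union w hdisj, marginal_union w hdisj]
    congr 1
    funext z
    rw [marginal_singleton, marginal_singleton, hw v (by simp)]
    have hupd : ∀ ζ, ∀ x ∈ Far, Function.update z v ζ x = z x := by
      intro ζ x hx
      exact Function.update_of_ne (by rintro rfl; exact hv hx) _ _
    rw [sum_vertexWeight_one_mul μ Θ q]
    · refine Finset.sum_congr rfl fun ζ _ => ?_
      congr 1
      simp only [Finset.forall_mem_insert, Function.update_self]
      by_cases h1 : ζ (.inl q) = ζ (.inr q) <;> simp [h1]
    · intro ζ ζ' h
      rw [hF v (by simp) z ζ ζ' h]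
      congr 1
      refine propext (forall₂_congr fun x hx => ?_)
      rw [hupd ζ x hx, hupd ζ' x hx]

/-- Outside the light cone of `T` the edge phases of each layer cancel. -/
theorem marginal_coneProd [DecidableEq V] (Θ : Angles p) (H : SimpleGraph V) (T : Set V)
    (S : Finset V)
    (w : V → Config p → ℂ) (hw : ∀ v ∉ T, w v = vertexWeight μ Θ 1) (q : ℕ) (hq : q ≤ p) :
    marginal w S (coneProd Θ H T p S) = marginal w S (coneProd Θ H T q S) := by
  classical
  induction hq using Nat.decreasingInduction with
  | self => rfl
  | of_succ q hq ih =>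
    rw [ih]
    set Far : Finset V := S.filter fun v => v ∉ H.nbhd T (p - 1 - q) with hFar
    have hsub : Far ⊆ S := Finset.filter_subset _ _
    have hwF : ∀ v ∈ Far, w v = vertexWeight μ Θ 1 := fun v hv =>
      hw v fun h => (Finset.mem_filter.1 hv).2 (H.mem_nbhd_of_mem _ h)
    have hdep : ∀ q' ≤ q + 1, ∀ v ∈ Far, ∀ (z : V → Config p) (ζ ζ' : Config p),
        (∀ i ≤ (⟨q, hq⟩ : Fin p).castSucc, ζ (.inl i) = ζ' (.inl i) ∧ ζ (.inr i) = ζ' (.inr i)) →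
        coneProd Θ H T q' S (Function.update z v ζ) =
          coneProd Θ H T q' S (Function.update z v ζ') := fun q' hq' v hv z ζ ζ' h =>
      coneProd_update Θ H T hq' S (Finset.mem_filter.1 hv).2 z fun i hi => h i hi
    rw [marginal_symm μ Θ w S Far hsub hwF (⟨q, hq⟩ : Fin p).castSucc _ (hdep (q + 1) le_rfl),
      marginal_symm μ Θ w S Far hsub hwF (⟨q, hq⟩ : Fin p).castSucc _ (hdep q (Nat.le_succ q))]
    congr 1
    funext z
    split_ifs with h
    · exact coneProd_succ_eq Θ H T ⟨q, hq⟩ S z fun v hv hv' =>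
        h v (Finset.mem_filter.2 ⟨hv, hv'⟩)
    · rfl

open Classical in
/-- The sum over the spins of `S` equals a sum over the ball of radius `p` around `T` in `S`, as
all edges that meet the light cone lie in this ball. -/
theorem marginal_eq_marginal_nbhd [DecidableEq V] (Θ : Angles p) (H : SimpleGraph V) (T : Set V)
    (S : Finset V)
    (w : V → Config p → ℂ) (hw : ∀ v ∉ T, w v = vertexWeight μ Θ 1) :
    marginal w S (edgeProd (edgeFactor Θ) H S) =
      marginal w (S.filter (· ∈ H.nbhd T p)) (coneProd Θ H T 0 (S.filter (· ∈ H.nbhd T p))) := by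
  set B := S.filter (· ∈ H.nbhd T p) with hB
  have hBS : B ⊆ S := Finset.filter_subset _ _
  have hdep : DependsOn (coneProd Θ H T 0 B) (B : Set V) := by
    refine DependsOn.finset_prod fun e he => DependsOn.finset_prod fun j _ => ?_
    intro z z' h
    have : e.map z = e.map z' :=
      Sym2.map_congr fun x hx => h x ((SimpleGraph.mem_edgesIn.1 he).1 x hx)
    simp only [this]
  have hcone : coneProd Θ H T 0 S = coneProd Θ H T 0 B := by
    funext z
    refine (Finset.prod_subset ?_ ?_).symm
    · intro e he
      rw [SimpleGraph.mem_edgesIn] at he ⊢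
      exact ⟨fun x hx => hBS (he.1 x hx), he.2⟩
    · intro e he heB
      refine Finset.prod_eq_one fun j _ => if_pos ⟨Nat.zero_le _, fun x hx hxT => heB ?_⟩
      rw [SimpleGraph.mem_edgesIn] at he ⊢
      refine ⟨fun v hv => Finset.mem_filter.2 ⟨he.1 v hv, ?_⟩, he.2⟩
      exact SimpleGraph.nbhd_mono (by have := j.2; omega)
        (SimpleGraph.mem_nbhd_succ_of_mem_edge he.2 hx hv hxT)
  have hS : S = B ∪ S \ B := by rw [Finset.union_sdiff_of_subset hBS]
  rw [← coneProd_top Θ H T S, marginal_coneProd μ Θ H T S w hw 0 (Nat.zero_le p), hcone]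
  conv_lhs => rw [hS]
  rw [marginal_union w Finset.disjoint_sdiff, marginal_of_dependsOn _ hdep]
  · exact_mod_cast Finset.disjoint_sdiff
  · intro k hk
    rw [hw k fun h => ?_, sum_vertexWeight_one]
    rw [Finset.mem_sdiff] at hk
    exact hk.2 (Finset.mem_filter.2 ⟨hk.1, H.mem_nbhd_of_mem _ h⟩)

/-- The light cone: two finite sets that contain the ball of radius `p` around `T` give the same
sum over all spins. -/
theorem marginal_eq_of_nbhd_subset [DecidableEq V] (Θ : Angles p) (H : SimpleGraph V) (T : Set V)
    (S S' : Finset V) (hS : H.nbhd T p ⊆ S) (hS' : H.nbhd T p ⊆ S')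
    (w : V → Config p → ℂ) (hw : ∀ v ∉ T, w v = vertexWeight μ Θ 1) :
    marginal w S (edgeProd (edgeFactor Θ) H S) = marginal w S' (edgeProd (edgeFactor Θ) H S') := by
  classical
  rw [marginal_eq_marginal_nbhd μ Θ H T S w hw, marginal_eq_marginal_nbhd μ Θ H T S' w hw]
  have : S.filter (· ∈ H.nbhd T p) = S'.filter (· ∈ H.nbhd T p) := by
    ext v
    simp only [Finset.mem_filter]
    exact ⟨fun h => ⟨hS' h.2, h.2⟩, fun h => ⟨hS h.2, h.2⟩⟩
  rw [this]

end HamQAOA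

/-! ### Product operators -/

namespace HamQAOA

open Matrix MeasureTheory

theorem tensorOp_diagonal {W : Type*} [Fintype W] (d : W → ℤˣ → ℂ) :
    tensorOp (fun v => Matrix.diagonal (d v)) = Matrix.diagonal fun x => ∏ v, d v (x v) := by
  ext x y
  rw [tensorOp, Matrix.of_apply]
  by_cases h : x = y
  · subst h; simp
  · rw [Matrix.diagonal_apply_ne _ h]
    obtain ⟨v, hv⟩ := Function.ne_iff.1 h
    exact Finset.prod_eq_zero (Finset.mem_univ v) (Matrix.diagonal_apply_ne _ hv)

theorem tensorOp_one {W : Type*} [Fintype W] : tensorOp (fun _ : W => (1 : QubitOp)) = 1 := by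
  have := tensorOp_diagonal (W := W) fun _ _ => 1
  simpa using this

variable {W : Type*} [Fintype W] [DecidableEq W]

theorem tensorOp_mul (P Q : W → QubitOp) :
    tensorOp P * tensorOp Q = tensorOp fun v => P v * Q v := by
  ext x y
  simp only [tensorOp, Matrix.mul_apply, Matrix.of_apply, ← Finset.prod_mul_distrib]
  rw [Finset.prod_univ_sum, Fintype.piFinset_univ]

theorem onQubit_apply (v : W) (P : QubitOp) (x y : W → ℤˣ) :
    onQubit v P x y =
      P (x v) (y v) * ∏ w ∈ Finset.univ.erase v, (1 : QubitOp) (x w) (y w) := by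
  rw [onQubit, tensorOp, Matrix.of_apply, ← Finset.mul_prod_erase _ _ (Finset.mem_univ v),
    Function.update_self]
  congr 1
  exact Finset.prod_congr rfl fun w hw => by rw [Function.update_of_ne (Finset.ne_of_mem_erase hw)]

theorem onQubit_smul (v : W) (a : ℂ) (P : QubitOp) : onQubit v (a • P) = a • onQubit v P := by
  ext x y
  simp [onQubit_apply, mul_assoc]

theorem onQubit_mul (v : W) (P Q : QubitOp) : onQubit v (P * Q) = onQubit v P * onQubit v Q := by
  rw [onQubit, onQubit, onQubit, tensorOp_mul]
  congr 1
  funext w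
  by_cases h : w = v
  · subst h; simp
  · simp [Function.update_of_ne h]

theorem onQubit_one (v : W) : onQubit v 1 = 1 := by
  rw [onQubit, ← tensorOp_one]
  congr 1
  exact Function.update_eq_self v _

theorem onQubit_mul_onQubit {u v : W} (h : u ≠ v) (P Q : QubitOp) :
    onQubit u P * onQubit v Q =
      tensorOp (Function.update (Function.update (fun _ => 1) u P) v Q) := by
  rw [onQubit, onQubit, tensorOp_mul]
  congr 1
  funext w
  by_cases hv : w = v
  · subst hv; simp [Function.update_of_ne h.symm]
  · by_cases hu : w = u
    · subst hu; simp [Function.update_of_ne hv]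
    · simp [Function.update_of_ne hu, Function.update_of_ne hv]

theorem onQubit_commute {u v : W} (h : u ≠ v) (P Q : QubitOp) :
    Commute (onQubit u P) (onQubit v Q) := by
  rw [commute_iff_eq, onQubit_mul_onQubit h, onQubit_mul_onQubit h.symm,
    Function.update_comm h]

theorem exp_onQubit (v : W) (P : QubitOp) :
    NormedSpace.exp (onQubit v P) = onQubit v (NormedSpace.exp P) := by
  let f : QubitOp →+* Op W :=
    { toFun := onQubit v
      map_one' := onQubit_one v
      map_mul' := onQubit_mul v
      map_zero' := by ext x y; simp [onQubit_apply]
      map_add' := fun P Q => by ext x y; simp [onQubit_apply, add_mul] }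
  have hf : Continuous f := by
    refine continuous_matrix fun x y => ?_
    show Continuous fun P : QubitOp => onQubit v P x y
    simp only [onQubit_apply]
    exact (continuous_id.matrix_elem _ _).mul continuous_const
  open scoped Norms.Operator in exact (NormedSpace.map_exp f hf P).symm

/-- The exponential of a sum of single-qubit operators is the product of their exponentials. -/
theorem exp_sum_onQubit (P : W → QubitOp) :
    NormedSpace.exp (∑ v, onQubit v (P v)) = tensorOp fun v => NormedSpace.exp (P v) := by
  have h : ∀ s : Finset W, NormedSpace.exp (∑ v ∈ s, onQubit v (P v)) =
      tensorOp fun v => if v ∈ s then NormedSpace.exp (P v) else 1 := by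
    intro s
    induction s using Finset.induction_on with
    | empty => simp [tensorOp_one]
    | insert u s hu ih =>
      rw [Finset.sum_insert hu, Matrix.exp_add_of_commute, ih, exp_onQubit, onQubit, tensorOp_mul]
      · congr 1
        funext w
        by_cases h : w = u
        · subst h; simp [hu]
        · simp [h]
      · exact Commute.sum_right _ _ _ fun w hw =>
          onQubit_commute (by rintro rfl; exact hu hw) _ _
  simpa using h Finset.univ

theorem evolve_sum_onQubit (θ : ℝ) (P : W → QubitOp) :
    evolve θ (∑ v, onQubit v (P v)) =
      tensorOp fun v => NormedSpace.exp ((-(Complex.I * (θ : ℂ))) • P v) := by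
  rw [evolve, Finset.smul_sum]
  simp only [← onQubit_smul]
  exact exp_sum_onQubit fun v => (-(Complex.I * (θ : ℂ))) • P v

open Classical in
/-- The value of `∑_{uv ∈ E} Z_u Z_v` on a computational-basis state. -/
noncomputable def isingEnergy (H : SimpleGraph W) (x : W → ℤˣ) : ℝ :=
  ∑ e ∈ H.edgeFinset, ((((e.map x).mul : ℤˣ) : ℤ) : ℝ)

theorem hamA_eq_diagonal (H : SimpleGraph W) :
    hamA H = Matrix.diagonal fun x => ((isingEnergy H x : ℝ) : ℂ) := by
  classical
  have h : ∀ e ∈ H.edgeFinset, tensorOp (fun w => if w ∈ e then pauliZ else 1) =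
      Matrix.diagonal fun x => (((((e.map x).mul : ℤˣ) : ℤ) : ℝ) : ℂ) := by
    intro e he
    have h1 : (fun w => if w ∈ e then pauliZ else 1) = fun w =>
        Matrix.diagonal fun s : ℤˣ => if w ∈ e then ((s : ℤ) : ℂ) else 1 := by
      funext w
      split_ifs <;> simp [pauliZ]
    rw [h1, tensorOp_diagonal]
    congr 1
    funext x
    induction e with
    | _ u v =>
      have huv : u ≠ v := (by simpa using he : H.Adj u v).ne
      have h2 : ∀ w, (if w ∈ s(u, v) then ((x w : ℤ) : ℂ) else 1) =
          (if w = u then ((x w : ℤ) : ℂ) else 1) * if w = v then ((x w : ℤ) : ℂ) else 1 := by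
        intro w
        by_cases hu : w = u
        · subst hu; simp [huv]
        · simp [hu]
      simp only [h2, Finset.prod_mul_distrib, Finset.prod_ite_eq', Finset.mem_univ, if_true]
      simp
  rw [hamA]
  ext x y
  rw [Matrix.sum_apply]
  convert (rfl : ∑ e ∈ H.edgeFinset,
    (Matrix.diagonal fun x => (((((e.map x).mul : ℤˣ) : ℤ) : ℝ) : ℂ)) x y = _) using 1
  · exact Finset.sum_congr rfl fun e he => by rw [← h e he]
  · by_cases hxy : x = y
    · subst hxy; simp [isingEnergy]
    · simp [hxy]

theorem evolve_hamA (θ : ℝ) (H : SimpleGraph W) :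
    evolve θ (hamA H) =
      Matrix.diagonal fun x => Complex.exp (-(Complex.I * (θ * isingEnergy H x : ℝ))) := by
  rw [evolve, hamA_eq_diagonal, ← Matrix.diagonal_smul, Matrix.exp_diagonal]
  congr 1
  funext x
  rw [Pi.coe_exp, ← Complex.exp_eq_exp_ℂ]
  simp [mul_assoc]

variable {p : ℕ}

theorem layer_apply (H : SimpleGraph W) (Θ : Angles p) (nn : W → Direction) (j : Fin p)
    (x y : W → ℤˣ) :
    layer H Θ nn j x y = (∏ v, ketFactor Θ (nn v) j (x v) (y v)) *
      Complex.exp (-(Complex.I * (Θ.α j * isingEnergy H y : ℝ))) := by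
  rw [layer, hamB, hamC, hamD, evolve_hamA, evolve_sum_onQubit, evolve_sum_onQubit,
    evolve_sum_onQubit, tensorOp_mul, tensorOp_mul, Matrix.mul_diagonal]
  rfl

/-- A product of matrices acting on a vector is a sum over paths. -/
theorem dotProduct_prod_mulVec {I : Type*} [Fintype I] [DecidableEq I] (M : Fin p → Matrix I I ℂ)
    (v g : I → ℂ) :
    ∑ x, g x * ((List.ofFn M).reverse.prod *ᵥ v) x =
      ∑ z : Fin (p + 1) → I,
        g (z (Fin.last p)) * (∏ j, M j (z j.succ) (z j.castSucc)) * v (z 0) := by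
  induction p generalizing g with
  | zero =>
    rw [← (Equiv.funUnique (Fin 1) I).symm.sum_comp]
    simp
  | succ p ih =>
    have h1 : (List.ofFn M).reverse.prod =
        M (Fin.last p) * (List.ofFn fun j : Fin p => M j.castSucc).reverse.prod := by
      rw [List.ofFn_succ', List.concat_eq_append, List.reverse_append]
      simp
    rw [h1, ← Matrix.mulVec_mulVec]
    have h2 : ∀ w : I → ℂ, ∑ x, g x * (M (Fin.last p) *ᵥ w) x =
        ∑ y, (∑ x, g x * M (Fin.last p) x y) * w y := by
      intro w
      simp only [Matrix.mulVec, dotProduct, Finset.mul_sum, Finset.sum_mul]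
      rw [Finset.sum_comm]
      simp only [mul_assoc]
    rw [h2, ih, sum_snoc]
    refine Finset.sum_congr rfl fun z _ => ?_
    rw [Finset.sum_mul, Finset.sum_mul]
    refine Finset.sum_congr rfl fun s _ => ?_
    have h3 : (Fin.snoc (α := fun _ => I) z s : Fin (p + 2) → I) 0 = z 0 :=
      Fin.snoc_castSucc (α := fun _ => I) s z 0
    have h4 : ∀ j : Fin p, (Fin.snoc (α := fun _ => I) z s : Fin (p + 2) → I) j.castSucc.succ =
        z j.succ := fun j => Fin.snoc_castSucc (α := fun _ => I) s z j.succ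
    simp only [Fin.prod_univ_castSucc, Fin.snoc_castSucc, h3, h4, Fin.snoc_last, Fin.succ_last]
    ring

end HamQAOA

/-! ### The expectation as a sum over configurations -/

namespace HamQAOA

open Matrix MeasureTheory AdditiveProduct

variable {p : ℕ}

section

variable {W : Type*} [Fintype W]

theorem edgePhase_eq_prod_layers (Θ : Angles p) (H : SimpleGraph W) (Z : W → Config p) :
    edgePhase Θ H Z =
      (∏ j : Fin p, star (Complex.exp (-(Complex.I *
        (Θ.α j * isingEnergy H (fun v => Z v (.inl j.castSucc)) : ℝ))))) *
      ∏ j : Fin p, Complex.exp (-(Complex.I *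
        (Θ.α j * isingEnergy H (fun v => Z v (.inr j.castSucc)) : ℝ))) := by
  have h : edgePhase Θ H Z = Complex.exp (Complex.I * ((∑ i, paramVec Θ i *
      isingEnergy H (fun v => Z v i) : ℝ) : ℂ)) := rfl
  rw [h, Fintype.sum_sum_type, Fin.sum_univ_castSucc, Fin.sum_univ_castSucc]
  simp only [paramVec, Sum.elim_inl, Sum.elim_inr, Fin.snoc_castSucc, Fin.snoc_last]
  simp only [Complex.star_def, ← Complex.exp_conj, ← Complex.exp_sum, ← Complex.exp_add]
  congr 1
  push_cast
  simp only [map_neg, map_mul, Complex.conj_I, Complex.conj_ofReal, mul_add, Finset.mul_sum,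
    zero_mul, neg_zero, add_zero]
  congr 1 <;> exact Finset.sum_congr rfl fun j _ => by ring

theorem sum_config_paths [DecidableEq W] {M : Type*} [AddCommMonoid M]
    (F : (Fin (p + 1) → W → ℤˣ) → (Fin (p + 1) → W → ℤˣ) → M) :
    ∑ Z : W → Config p, F (fun i v => Z v (.inl i)) (fun i v => Z v (.inr i)) =
      ∑ x, ∑ y, F x y := by
  rw [← Fintype.sum_prod_type']
  let e : (W → Config p) ≃ (Fin (p + 1) → W → ℤˣ) × (Fin (p + 1) → W → ℤˣ) :=
    { toFun := fun Z => (fun i v => Z v (.inl i), fun i v => Z v (.inr i))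
      invFun := fun q v => Sum.elim (fun i => q.1 i v) fun i => q.2 i v
      left_inv := fun Z => by funext v i; cases i <;> rfl
      right_inv := fun q => rfl }
  exact Fintype.sum_equiv e _ _ fun Z => rfl

theorem integrable_prod_siteAmp (μ : Measure (Direction × Direction))
    [IsProbabilityMeasure μ] (Θ : Angles p) (σ : W → QubitOp) (Z : W → Config p) :
    Integrable (fun mn : W → Direction × Direction => ∏ v, siteAmp Θ (σ v) (Z v) (mn v))
      (Measure.pi fun _ => μ) :=
  Integrable.fintype_prod fun v => (isBddMeas_siteAmp Θ (σ v) (Z v)).integrable μ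

variable [DecidableEq W]

/-- For fixed directions, the expectation of a product operator is a sum over pairs of paths. -/
theorem expect_state_tensorOp (H : SimpleGraph W) (Θ : Angles p) (nn mm : W → Direction)
    (σ : W → QubitOp) :
    expect (state H Θ nn mm) (tensorOp σ) = ∑ Z : W → Config p,
      (∏ v, siteAmp Θ (σ v) (Z v) (mm v, nn v)) * edgePhase Θ H Z := by
  set M := layer H Θ nn with hM
  set b : (W → ℤˣ) → ℂ := fun x => ∏ v, blochKet (mm v) (x v) with hb
  have hψ : state H Θ nn mm = (List.ofFn M).reverse.prod *ᵥ b := rfl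
  set ψ := state H Θ nn mm with hψdef
  have h1 : expect ψ (tensorOp σ) = ∑ y, (∑ x, star (ψ x) * tensorOp σ x y) * ψ y := by
    simp only [expect, dotProduct, Matrix.mulVec, Finset.mul_sum, Finset.sum_mul, Pi.star_apply]
    rw [Finset.sum_comm]
    simp only [mul_assoc]
  have h2 : ∀ y, ∑ x, star (ψ x) * tensorOp σ x y = ∑ z : Fin (p + 1) → W → ℤˣ,
      tensorOp σ (z (Fin.last p)) y *
        star ((∏ j, M j (z j.succ) (z j.castSucc)) * b (z 0)) := by
    intro y
    have h3 := congrArg star (dotProduct_prod_mulVec M b fun x => star (tensorOp σ x y))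
    rw [← hψ, star_sum, star_sum] at h3
    simp only [StarMul.star_mul, star_star] at h3
    rw [h3]
    refine Finset.sum_congr rfl fun z _ => ?_
    rw [StarMul.star_mul]
    ring
  rw [h1]
  simp only [h2]
  rw [hψ, dotProduct_prod_mulVec M b fun y => ∑ z : Fin (p + 1) → W → ℤˣ,
      tensorOp σ (z (Fin.last p)) y *
        star ((∏ j, M j (z j.succ) (z j.castSucc)) * b (z 0))]
  simp only [Finset.sum_mul]
  rw [Finset.sum_comm, ← sum_config_paths fun x y => tensorOp σ (x (Fin.last p)) (y (Fin.last p)) *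
    star ((∏ j, M j (x j.succ) (x j.castSucc)) * b (x 0)) *
    (∏ j, M j (y j.succ) (y j.castSucc)) * b (y 0)]
  refine Finset.sum_congr rfl fun Z _ => ?_
  rw [edgePhase_eq_prod_layers]
  have hbra : ∀ (v : W) (j : Fin p) (s t : ℤˣ), braFactor Θ (nn v) j s t =
      star (ketFactor Θ (nn v) j t s) := by
    intro v j s t
    rw [← conjTranspose_ketFactor, Matrix.conjTranspose_apply]
  simp only [siteAmp, hM, layer_apply, hb, hbra, Finset.prod_mul_distrib, StarMul.star_mul,
    star_prod, tensorOp, Matrix.of_apply]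
  rw [Finset.prod_comm (s := (Finset.univ : Finset W)),
    Finset.prod_comm (s := (Finset.univ : Finset W))]
  ring

variable (μ : Measure (Direction × Direction)) [IsProbabilityMeasure μ]

theorem integrable_expect (H : SimpleGraph W) (Θ : Angles p) (σ : W → QubitOp) :
    Integrable (fun mn : W → Direction × Direction =>
      expect (state H Θ (fun v => (mn v).2) (fun v => (mn v).1)) (tensorOp σ))
      (Measure.pi fun _ => μ) := by
  simp only [expect_state_tensorOp]
  exact integrable_finsetSum _ fun Z _ => (integrable_prod_siteAmp μ Θ σ Z).mul_const _

/-- The averaged expectation of a product operator is a partition function with single-spin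
weights `f^σ`. -/
theorem meanExpect_tensorOp (H : SimpleGraph W) (Θ : Angles p) (σ : W → QubitOp) :
    meanExpect μ H Θ (tensorOp σ) = ∑ Z : W → Config p,
      (∏ v, vertexWeight μ Θ (σ v) (Z v)) * edgePhase Θ H Z := by
  rw [meanExpect]
  simp only [expect_state_tensorOp]
  rw [integral_finsetSum _ fun Z _ => (integrable_prod_siteAmp μ Θ σ Z).mul_const _]
  refine Finset.sum_congr rfl fun Z _ => ?_
  rw [integral_mul_const, integral_fintype_prod_eq_prod]
  rfl

theorem expect_sub (ψ : (W → ℤˣ) → ℂ) (O O' : Op W) :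
    expect ψ (O - O') = expect ψ O - expect ψ O' := by
  rw [expect, Matrix.sub_mulVec, dotProduct_sub]
  rfl

theorem expect_smul (ψ : (W → ℤˣ) → ℂ) (a : ℂ) (O : Op W) :
    expect ψ (a • O) = a * expect ψ O := by
  rw [expect, Matrix.smul_mulVec, dotProduct_smul]
  rfl

theorem meanExpect_qmcTerm (H : SimpleGraph W) (Θ : Angles p) {u v : W} (h : u ≠ v) :
    meanExpect μ H Θ (qmcTerm u v) = 1 / 2 *
      (meanExpect μ H Θ (onQubit u 1 * onQubit v 1) -
        meanExpect μ H Θ (onQubit u pauliX * onQubit v pauliX) -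
        meanExpect μ H Θ (onQubit u pauliY * onQubit v pauliY) -
        meanExpect μ H Θ (onQubit u pauliZ * onQubit v pauliZ)) := by
  have hint : ∀ P : QubitOp, Integrable (fun mn : W → Direction × Direction =>
      expect (state H Θ (fun v => (mn v).2) (fun v => (mn v).1)) (onQubit u P * onQubit v P))
      (Measure.pi fun _ => μ) := by
    intro P
    rw [onQubit_mul_onQubit h]
    exact integrable_expect μ H Θ _
  have h1 : (1 : Op W) = onQubit u 1 * onQubit v 1 := by rw [onQubit_one, onQubit_one, mul_one]
  rw [qmcTerm, h1]
  simp only [meanExpect, expect_smul, expect_sub]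
  rw [integral_const_mul, integral_sub, integral_sub, integral_sub]
  · exact hint _
  · exact hint _
  · exact (hint _).sub (hint _)
  · exact hint _
  · exact ((hint _).sub (hint _)).sub (hint _)
  · exact hint _

end

variable {V : Type*} [DecidableEq V] (μ : Measure (Direction × Direction)) [IsProbabilityMeasure μ]

/-- The averaged expectation in an induced subgraph as a sum over the spins of its vertices. -/
theorem meanExpect_induce (G : SimpleGraph V) (S : Finset V) (Θ : Angles p) {L R : S} (hLR : L ≠ R)
    (σ : QubitOp) (z : V → Config p) :
    meanExpect μ (G.induce (S : Set V)) Θ (onQubit L σ * onQubit R σ) =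
      marginal (fun v => vertexWeight μ Θ (if v = L.1 ∨ v = R.1 then σ else 1)) S
        (edgeProd (edgeFactor Θ) G S) z := by
  rw [onQubit_mul_onQubit hLR, meanExpect_tensorOp, marginal]
  refine Finset.sum_congr rfl fun Z _ => ?_
  congr 1
  · refine Finset.prod_congr rfl fun k _ => ?_
    congr 1
    by_cases hR : k = R
    · subst hR; simp
    · by_cases hL : k = L
      · subst hL; simp [Function.update_of_ne hR]
      · rw [Function.update_of_ne hR, Function.update_of_ne hL, if_neg]
        rintro (h | h)
        · exact hL (Subtype.ext h)
        · exact hR (Subtype.ext h)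
  · rw [edgeProd_eq_edgePhase Θ G (G.induce (S : Set V)) Subtype.val Subtype.val_injective
      (fun _ _ => Iff.rfl) S (fun v => by simp)]
    congr 1
    funext k
    have hk : k.1 ∈ S := k.2
    simp [Function.updateFinset]

end HamQAOA

theorem mainTheorem3 {n c p : ℕ} (A : Fin c → SimpleGraph (Fin n))
    (hA : AdditiveProduct.IsAtomFamily A) (v₁ : Fin n)
    (μ : MeasureTheory.Measure (HamQAOA.Direction × HamQAOA.Direction))
    [MeasureTheory.IsProbabilityMeasure μ] (Θ : HamQAOA.Angles p)
    (C : Fin c) (a b : Fin n) (hab : (A C).Adj a b)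
    (S : Finset (AdditiveProduct.Vertex A v₁)) (L R : S)
    (hLR : AdditiveProduct.IsEdgeOfType C L.1 R.1) (hL : L.1.last = a) (hR : R.1.last = b)
    (hS : (AdditiveProduct.graph A v₁).nbhd {L.1, R.1} p ⊆ S) :
    (∀ σ ∈ ({1, HamQAOA.pauliX, HamQAOA.pauliY, HamQAOA.pauliZ} : Set HamQAOA.QubitOp),
      HamQAOA.meanExpect μ ((AdditiveProduct.graph A v₁).induce (S : Set _)) Θ
        (HamQAOA.onQubit L σ * HamQAOA.onQubit R σ) = HamQAOA.edgeSum μ Θ A C a b σ) ∧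
    HamQAOA.meanExpect μ ((AdditiveProduct.graph A v₁).induce (S : Set _)) Θ
        (HamQAOA.qmcTerm L R) =
      1 / 2 * (HamQAOA.edgeSum μ Θ A C a b 1 - HamQAOA.edgeSum μ Θ A C a b HamQAOA.pauliX
        - HamQAOA.edgeSum μ Θ A C a b HamQAOA.pauliY
        - HamQAOA.edgeSum μ Θ A C a b HamQAOA.pauliZ) := by
  have hne : L ≠ R := by
    rintro rfl
    exact hLR.1.ne rfl
  have key : ∀ σ : HamQAOA.QubitOp,
      HamQAOA.meanExpect μ ((AdditiveProduct.graph A v₁).induce (S : Set _)) Θ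
        (HamQAOA.onQubit L σ * HamQAOA.onQubit R σ) = HamQAOA.edgeSum μ Θ A C a b σ := by
    intro σ
    subst hL hR
    rw [← HamQAOA.marginal_edgeNbhd μ Θ σ hLR fun _ _ => 1,
      ← HamQAOA.marginal_eq_of_nbhd_subset μ Θ (AdditiveProduct.graph A v₁) {L.1, R.1} S _ hS
        (HamQAOA.nbhd_subset_edgeNbhd hLR p)]
    · exact HamQAOA.meanExpect_induce μ (AdditiveProduct.graph A v₁) S Θ hne σ _
    · intro v hv
      simp only [Set.mem_insert_iff, Set.mem_singleton_iff] at hv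
      rw [if_neg hv]
  refine ⟨fun σ _ => key σ, ?_⟩
  rw [← key, ← key, ← key, ← key]
  exact HamQAOA.meanExpect_qmcTerm μ _ Θ hne
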